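/- Let $\theta\in(0,1]$, let $\lambda_t\ge 0$ $(t\ge0)$ be a measurable hazard rate with $\Lambda_t=\int_0^t\lambda_u\,du<\infty$ for all $t$, and let $a_t$ be measurable with $0\le a_t\le 1+1/\theta$. Let $\{Z_t\}_{t\ge0}$, $Z_0=1$, be the theta-positive branching process with parameter $\theta$ in the varying environment $(\{\lambda_t\},\{a_t\})$: the time-inhomogeneous Markov branching process, with values in $\{0,1,2,\dots\}$, in which each individual alive at time $t$, independently of the others, dies at rate $\lambda_t$, and an individual dying at time $t$ is instantaneously replaced by $k$ offspring with probability $p_t(k)$, where $$\sum_{k\ge0}p_t(k)s^k=1-a_t(1-s)+\frac{a_t}{1+\theta}(1-s)^{1+\theta}.$$ (That is, $Z$ is a càdlàg solution of the martingale problem, on functions $f$ of finite support, for the generators $(A_tf)(n)=n\lambda_t\big(\sum_k p_t(k)f(n-1+k)-f(n)\big)$.) Put $$\mu_t=E(Z_t),\qquad m_t=E(Z_t\mid Z_t>0),\qquad V_{t,\theta}=\frac{\theta}{1+\theta}\int_0^t\mu_u^{-\theta}\lambda_u\,du,\qquad V_\theta=\lim_{t\to\infty}V_{t,\theta}.$$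 These are well defined: for every $t\ge 0$, $E(Z_t)<\infty$, $P(Z_t>0)>0$ and $\mu_u^{-\theta}\lambda_u$ is integrable on $[0,t]$. The process is called strictly subcritical if $\lim_{t\to\infty}P(Z_t=0)=1$ and $\lim_{t\to\infty}m_t$ exists and lies in $[1,\infty)$. The process is strictly subcritical if and only if $V_\theta=\infty$ and $\mu_t^\theta V_{t,\theta}\to M_\theta$ as $t\to\infty$ for some $M_\theta\in[0,\infty)$. In this case, as $t\to\infty$, $\mu_t\to0$, $$m_t\to m,\qquad m=\Big(M_\theta+\frac{\theta}{1+\theta}\Big)^{1/\theta},\qquad P(Z_t>0)\sim m^{-1}\mu_t,$$ and for every $s\in[0,1)$ $$E\big(s^{Z_t}\mid Z_t>0\big)\to 1-m\Big(M_\theta-\frac1{1+\theta}+(1-s)^{-\theta}\Big)^{-1/\theta}.$$ -/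

import Mathlib

open MeasureTheory ProbabilityTheory Filter Topology Asymptotics
open scoped NNReal

namespace ThetaBranching

/-- The probability generating function
`h(s) = 1 - a (1 - s) + a (1 - s)^{1+θ} / (1 + θ)` of the offspring number of an individual, where
`a` is the mean offspring number. -/
noncomputable def offspringPGF (θ a s : ℝ) : ℝ :=
  1 - a * (1 - s) + a * (1 + θ)⁻¹ * (1 - s) ^ (1 + θ)

/-- The probability that a dying individual is replaced by `k` offspring when the mean offspring
number is `a`: `p(0) = 1 - θ a / (1 + θ)`, `p(1) = 0` and
`p(n) = θ (1 - θ) (2 - θ) ⋯ (n - 2 - θ) a / n!` for `n ≥ 2`. -/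
noncomputable def offspringProb (θ a : ℝ) : ℕ → ℝ
  | 0 => 1 - θ * (1 + θ)⁻¹ * a
  | 1 => 0
  | n + 2 => θ * (∏ i ∈ Finset.range n, ((i : ℝ) + 1 - θ)) * a / (Nat.factorial (n + 2) : ℝ)

/-- `offspringPGF` is the generating function of `offspringProb`. -/
theorem hasSum_offspringProb {θ : ℝ} (hθ : 0 < θ) (a : ℝ) {s : ℝ} (hs0 : 0 ≤ s) (hs1 : s < 1) :
    HasSum (fun k => offspringProb θ a k * s ^ k) (offspringPGF θ a s) := by
  have hne : (1 + θ) ≠ 0 := by positivity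
  have hball : -s ∈ Metric.eball (0 : ℝ) 1 := by
    rw [← ENNReal.ofReal_one, Metric.eball_ofReal]
    simpa [abs_of_nonneg hs0] using hs1
  have h1 := (Real.one_add_rpow_hasFPowerSeriesOnBall_zero (a := 1 + θ)).hasSum hball
  have hD : ∀ n : ℕ, (descPochhammer ℤ (n + 2)).smeval (1 + θ) * (-1) ^ n =
      (1 + θ) * θ * ∏ i ∈ Finset.range n, ((i : ℝ) + 1 - θ) := by
    intro n
    induction n with
    | zero =>
      simp [descPochhammer_succ_right, Polynomial.smeval_mul]
    | succ n ih =>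
      rw [Finset.prod_range_succ, ← mul_assoc, ← ih, descPochhammer_succ_right,
        Polynomial.smeval_mul]
      simp only [Polynomial.smeval_sub, Polynomial.smeval_X, Polynomial.smeval_natCast]
      simp
      ring
  have h2 : HasSum (fun n : ℕ => Ring.choose (1 + θ) n * (-s) ^ n) ((1 - s) ^ (1 + θ)) := by
    simp only [binomialSeries_apply, List.ofFn_const, List.prod_replicate, smul_eq_mul,
      zero_add] at h1
    rwa [← sub_eq_add_neg] at h1
  have h3 := h2.mul_left (a * (1 + θ)⁻¹)
  have h4 : HasSum (fun n : ℕ => if n = 0 then (1 - a) else 0) (1 - a) := hasSum_ite_eq 0 _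
  have h5 : HasSum (fun n : ℕ => if n = 1 then a * s else 0) (a * s) := hasSum_ite_eq 1 _
  have h6 := (h4.add h5).add h3
  have e : 1 - a + a * s + a * (1 + θ)⁻¹ * (1 - s) ^ (1 + θ) = offspringPGF θ a s := by
    rw [offspringPGF]; ring
  rw [e] at h6
  refine h6.congr_fun ?_
  intro n
  match n with
  | 0 => simp [offspringProb]; field_simp; ring
  | 1 => simp [offspringProb]; field_simp; ring
  | n + 2 =>
    have hf : ((Nat.factorial (n + 2) : ℕ) : ℝ) ≠ 0 := by positivity
    have := hD n
    simp only [offspringProb, Ring.choose_eq_smul, smul_eq_mul]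
    rw [neg_pow s (n + 2), pow_add (-1 : ℝ) n 2]
    simp
    field_simp
    linear_combination (-a * s ^ (n + 2)) * this

/-- The generator at time `u` of the branching population with death rate `lam u` per individual
and mean offspring number `a u`: when `n` individuals are alive, each one of them dies at rate
`lam u`, independently of the others, and is replaced at once by `k` offspring with probability
`offspringProb θ (a u) k`, so that the population size jumps from `n` to `n - 1 + k` at rate
`n * lam u * offspringProb θ (a u) k`. -/
noncomputable def generator (θ : ℝ) (lam a : ℝ → ℝ) (f : ℕ → ℝ) (u : ℝ) (n : ℕ) : ℝ :=
  n * lam u * (∑' k : ℕ, offspringProb θ (a u) k * f (n - 1 + k) - f n)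

/-- `Z` is a theta-positive branching process in the varying environment `(lam, a)` with branching
parameter `θ`, with respect to the filtration `ℱ`: it is an adapted process started from one
individual, with values in the finite population sizes `ℕ` and càdlàg paths (for the discrete
topology of `ℕ`), which solves the martingale problem for `generator θ lam a`, on the
functions of finite support. -/
structure IsThetaPositiveBranchingProcess {Ω : Type*} [mΩ : MeasurableSpace Ω] (P : Measure Ω)
    (ℱ : Filtration ℝ≥0 mΩ) (θ : ℝ) (lam a : ℝ → ℝ) (Z : ℝ≥0 → Ω → ℕ) : Prop where
  adapted : ∀ t, Measurable[ℱ t] (Z t)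
  init : ∀ᵐ ω ∂P, Z 0 ω = 1
  right_cont : ∀ ω t, ContinuousWithinAt (fun r => Z r ω) (Set.Ici t) t
  left_lim : ∀ ω t, ∃ n : ℕ, Tendsto (fun r => Z r ω) (𝓝[<] t) (𝓝 n)
  martingale : ∀ f : ℕ → ℝ, f.support.Finite →
    Martingale (fun (t : ℝ≥0) ω =>
      f (Z t ω) - ∫ u in (0 : ℝ)..t, generator θ lam a f u (Z u.toNNReal ω)) ℱ P

variable {Ω : Type*} [MeasurableSpace Ω]

/-- The mean population size `μ_t = E(Z_t)`. -/
noncomputable def meanSize (P : Measure Ω) (Z : ℝ≥0 → Ω → ℕ) (t : ℝ≥0) : ℝ :=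
  ∫ ω, (Z t ω : ℝ) ∂P

/-- The conditional mean population size `m_t = E(Z_t | Z_t > 0)`. -/
noncomputable def condMeanSize (P : Measure Ω) (Z : ℝ≥0 → Ω → ℕ) (t : ℝ≥0) : ℝ :=
  ∫ ω, (Z t ω : ℝ) ∂(P[|{ω | 0 < Z t ω}])

/-- The conditional generating function `E(s^{Z_t} | Z_t > 0)`. -/
noncomputable def condPGF (P : Measure Ω) (Z : ℝ≥0 → Ω → ℕ) (t : ℝ≥0) (s : ℝ) : ℝ :=
  ∫ ω, s ^ Z t ω ∂(P[|{ω | 0 < Z t ω}])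

/-- The survival probability `P(Z_t > 0)`. -/
noncomputable def survivalProb (P : Measure Ω) (Z : ℝ≥0 → Ω → ℕ) (t : ℝ≥0) : ℝ :=
  P.real {ω | 0 < Z t ω}

/-- The process is strictly subcritical: the extinction probability `q = lim P(Z_t = 0)` is `1`,
and `m_t` has a limit in `[1, ∞)`. -/
def StrictlySubcritical (P : Measure Ω) (Z : ℝ≥0 → Ω → ℕ) : Prop :=
  Tendsto (fun t => P.real {ω | Z t ω = 0}) atTop (𝓝 1) ∧
    ∃ m : ℝ, 1 ≤ m ∧ Tendsto (condMeanSize P Z) atTop (𝓝 m)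

/-- The integrand `μ_u^{-θ} λ_u` of `V_{t,θ}`. -/
noncomputable def vIntegrand (P : Measure Ω) (θ : ℝ) (lam : ℝ → ℝ) (Z : ℝ≥0 → Ω → ℕ)
    (u : ℝ) : ℝ :=
  meanSize P Z u.toNNReal ^ (-θ) * lam u

/-- `V_{t,θ} = θ (1 + θ)^{-1} ∫_0^t μ_u^{-θ} λ_u du`. -/
noncomputable def V (P : Measure Ω) (θ : ℝ) (lam : ℝ → ℝ) (Z : ℝ≥0 → Ω → ℕ) (t : ℝ≥0) : ℝ :=
  θ * (1 + θ)⁻¹ * ∫ u in (0 : ℝ)..t, vIntegrand P θ lam Z u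

end ThetaBranching

/-! The generating function of $Z_T$ is explicit, and every claim is read off from it. Testing the
martingale problem on indicators of single states gives the Kolmogorov forward equations for
$p_m(u)=P(Z_u=m)$ (`sizeProb_eq_add_integral`). If $\varphi$ solves the backward equation
$\varphi'=-\lambda(h(\varphi)-\varphi)$, where $h$ is the offspring generating function at time $u$,
then $\sum_m p_m(u)\varphi(u)^m$ does not depend on $u$, so $E(\varphi(T)^{Z_T})=\varphi(0)$
(`hasSum_mul_pow_of_forward`). This duality needs neither the branching property nor moments of $Z$.
All equations hold only for almost every time, the environment being merely measurable, so
differentiation is replaced by absolute continuity throughout.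

For theta-positive offspring laws $y=1-\varphi$ solves a Bernoulli equation, and $W=y^{-\theta}$ a
linear one with integrating factor $\mu_u^\theta$. Its solution with $\varphi(T)=s$ gives
(`hasSum_pgf_of_forward`) $E(s^{Z_t})=1-\mu_t B_t(s)^{-1/\theta}$, where
$B_t(s)=(1-s)^{-\theta}-\frac1{1+\theta}+\mu_t^\theta V_{t,\theta}+\frac{\mu_t^\theta}{1+\theta}$.
Letting $s\uparrow1$ identifies $\mu_t$ as the mean; $s=0$ gives $P(Z_t>0)=\mu_t/m_t$ and
$m_t^\theta=B_t(0)$.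

If the process is strictly subcritical, then $\mu_t=m_tP(Z_t>0)\to0$; the bound
$\mu_t^{-\theta}\le1+(1+\theta)V_{t,\theta}$, a consequence of $a\ge0$, forces $V_\theta=\infty$,
and the formula for $m_t^\theta$ makes $\mu_t^\theta V_{t,\theta}$ converge. Conversely,
$\mu_t^\theta=(\mu_t^\theta V_{t,\theta})/V_{t,\theta}\to0$, and the limits of $B_t(s)$ give
everything else. -/

/-! ### Calculus of absolutely continuous functions. -/

/-- The composition of a Lipschitz function with an absolutely continuous function is absolutely
continuous. -/
theorem LipschitzOnWith.comp_absolutelyContinuousOnInterval {X Y : Type*} [PseudoMetricSpace X]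
    [PseudoMetricSpace Y] {g : X → Y} {f : ℝ → X} {s : Set X} {K : ℝ≥0} {a b : ℝ}
    (hg : LipschitzOnWith K g s) (hf : AbsolutelyContinuousOnInterval f a b)
    (hfs : Set.MapsTo f (Set.uIcc a b) s) :
    AbsolutelyContinuousOnInterval (fun x => g (f x)) a b := by
  rw [absolutelyContinuousOnInterval_iff] at hf ⊢
  intro ε hε
  obtain ⟨δ, hδ, h⟩ := hf (ε / (K + 1)) (by positivity)
  refine ⟨δ, hδ, fun E hE hlt => ?_⟩
  have h1 := h E hE hlt
  calc ∑ i ∈ Finset.range E.1, dist (g (f (E.2 i).1)) (g (f (E.2 i).2))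
      ≤ ∑ i ∈ Finset.range E.1, K * dist (f (E.2 i).1) (f (E.2 i).2) :=
        Finset.sum_le_sum fun i hi =>
          hg.dist_le_mul _ (hfs (hE.1 i hi).1) _ (hfs (hE.1 i hi).2)
    _ = K * ∑ i ∈ Finset.range E.1, dist (f (E.2 i).1) (f (E.2 i).2) := by rw [Finset.mul_sum]
    _ ≤ K * (ε / (K + 1)) := by gcongr
    _ < (K + 1) * (ε / (K + 1)) := by gcongr; linarith
    _ = ε := by field_simp

/-- The composition of a function, `C¹` on a compact interval, with an absolutely continuous
function with values in this interval is absolutely continuous. -/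
theorem ContDiffOn.comp_absolutelyContinuousOnInterval {g f : ℝ → ℝ} {a b c d : ℝ}
    (hg : ContDiffOn ℝ 1 g (Set.Icc c d)) (hf : AbsolutelyContinuousOnInterval f a b)
    (hfs : Set.MapsTo f (Set.uIcc a b) (Set.Icc c d)) :
    AbsolutelyContinuousOnInterval (fun x => g (f x)) a b := by
  obtain ⟨K, hK⟩ := hg.exists_lipschitzOnWith (by decide) (convex_Icc _ _) isCompact_Icc
  exact hK.comp_absolutelyContinuousOnInterval hf hfs

/-- The composition of a `C¹` function with an absolutely continuous function is absolutely
continuous. -/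
theorem ContDiff.comp_absolutelyContinuousOnInterval {g f : ℝ → ℝ} {a b : ℝ}
    (hg : ContDiff ℝ 1 g) (hf : AbsolutelyContinuousOnInterval f a b) :
    AbsolutelyContinuousOnInterval (fun x => g (f x)) a b := by
  obtain ⟨C, hC⟩ := hf.exists_bound
  exact hg.contDiffOn.comp_absolutelyContinuousOnInterval (c := -C) (d := C) hf
    fun x hx => abs_le.1 (hC x hx)

theorem AbsolutelyContinuousOnInterval.const (c a b : ℝ) :
    AbsolutelyContinuousOnInterval (fun _ => c) a b :=
  (contDiff_const.contDiffOn).absolutelyContinuousOnInterval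

theorem AbsolutelyContinuousOnInterval.pow {f : ℝ → ℝ} {a b : ℝ}
    (hf : AbsolutelyContinuousOnInterval f a b) (n : ℕ) :
    AbsolutelyContinuousOnInterval (fun x => f x ^ n) a b :=
  (contDiff_id.pow n).comp_absolutelyContinuousOnInterval hf

/-- An absolutely continuous function is the integral of its almost everywhere derivative. -/
theorem AbsolutelyContinuousOnInterval.integral_eq_sub_of_ae_hasDerivAt {f f' : ℝ → ℝ} {a b : ℝ}
    (hf : AbsolutelyContinuousOnInterval f a b)
    (hf' : ∀ᵐ x, x ∈ Set.uIcc a b → HasDerivAt f (f' x) x) :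
    ∫ x in a..b, f' x = f b - f a := by
  rw [← hf.integral_deriv_eq_sub]
  refine intervalIntegral.integral_congr_ae ?_
  filter_upwards [hf'] with x hx hxm
  exact (hx (Set.uIoc_subset_uIcc hxm)).deriv.symm

/-- An absolutely continuous function whose derivative is nonnegative almost everywhere is
monotone. -/
theorem AbsolutelyContinuousOnInterval.le_of_ae_hasDerivAt_nonneg {f f' : ℝ → ℝ} {a b : ℝ}
    (hab : a ≤ b) (hf : AbsolutelyContinuousOnInterval f a b)
    (hf' : ∀ᵐ x, x ∈ Set.uIcc a b → HasDerivAt f (f' x) x)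
    (h0 : ∀ x ∈ Set.Icc a b, 0 ≤ f' x) : f a ≤ f b := by
  have h := hf.integral_eq_sub_of_ae_hasDerivAt hf'
  have : 0 ≤ ∫ x in a..b, f' x := intervalIntegral.integral_nonneg hab h0
  linarith

/-! ### The offspring distribution. -/

namespace ThetaBranching

section Offspring

variable {θ a : ℝ}

/-- The bound $a\le1+1/\theta$ is exactly $p(0)\ge0$; the other weights are nonnegative because
$\theta\le1$. -/
theorem offspringProb_nonneg (hθ0 : 0 < θ) (hθ1 : θ ≤ 1) (ha0 : 0 ≤ a) (ha1 : a ≤ 1 + 1 / θ)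
    (k : ℕ) : 0 ≤ offspringProb θ a k := by
  match k with
  | 0 =>
    have : θ * (1 + θ)⁻¹ * a ≤ θ * (1 + θ)⁻¹ * (1 + 1 / θ) := by gcongr
    have h2 : θ * (1 + θ)⁻¹ * (1 + 1 / θ) = 1 := by field_simp; ring
    simp only [offspringProb]
    linarith
  | 1 => simp [offspringProb]
  | n + 2 =>
    have : 0 ≤ ∏ i ∈ Finset.range n, ((i : ℝ) + 1 - θ) :=
      Finset.prod_nonneg fun i _ => by
        have : (0 : ℝ) ≤ i := by positivity
        linarith
    simp only [offspringProb]
    positivity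

theorem offspringPGF_le_one (hθ0 : 0 < θ) (ha0 : 0 ≤ a) {s : ℝ} (hs0 : 0 ≤ s) (hs1 : s ≤ 1) :
    offspringPGF θ a s ≤ 1 := by
  have h1 : (1 - s) ^ (1 + θ) ≤ (1 - s) := by
    conv_rhs => rw [← Real.rpow_one (1 - s)]
    exact Real.rpow_le_rpow_of_exponent_ge' (by linarith) (by linarith) zero_le_one (by linarith)
  have h2 : (1 + θ)⁻¹ ≤ 1 := inv_le_one_of_one_le₀ (by linarith)
  have h3 : (1 + θ)⁻¹ * (1 - s) ^ (1 + θ) ≤ 1 * (1 - s) := by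
    gcongr
  have h4 := mul_le_mul_of_nonneg_left h3 ha0
  simp only [offspringPGF]
  nlinarith

theorem offspringPGF_nonneg (hθ0 : 0 < θ) (hθ1 : θ ≤ 1) (ha0 : 0 ≤ a) (ha1 : a ≤ 1 + 1 / θ)
    {s : ℝ} (hs0 : 0 ≤ s) (hs1 : s < 1) : 0 ≤ offspringPGF θ a s :=
  (hasSum_offspringProb hθ0 a hs0 hs1).nonneg fun k =>
    mul_nonneg (offspringProb_nonneg hθ0 hθ1 ha0 ha1 k) (pow_nonneg hs0 k)

/-- A single term $p(k)s^k$ is at most the whole sum, hence at most 1; then $s\uparrow1$. The power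
series is thus used only inside its disc of convergence. -/
theorem offspringProb_le_one (hθ0 : 0 < θ) (hθ1 : θ ≤ 1) (ha0 : 0 ≤ a) (ha1 : a ≤ 1 + 1 / θ)
    (k : ℕ) : offspringProb θ a k ≤ 1 := by
  have hlim : Tendsto (fun s : ℝ => offspringProb θ a k * s ^ k) (𝓝[<] 1)
      (𝓝 (offspringProb θ a k * 1 ^ k)) :=
    ((continuous_const.mul (continuous_pow k)).tendsto 1).mono_left nhdsWithin_le_nhds
  rw [one_pow, mul_one] at hlim
  refine le_of_tendsto hlim ?_
  filter_upwards [Ioo_mem_nhdsLT (zero_lt_one (α := ℝ))] with s hs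
  refine le_trans ?_ (offspringPGF_le_one (a := a) hθ0 ha0 hs.1.le hs.2.le)
  exact le_hasSum (hasSum_offspringProb hθ0 a hs.1.le hs.2) k fun j _ =>
    mul_nonneg (offspringProb_nonneg hθ0 hθ1 ha0 ha1 j) (pow_nonneg hs.1.le j)

theorem measurable_offspringProb (θ : ℝ) (k : ℕ) : Measurable fun a => offspringProb θ a k := by
  match k with
  | 0 => simp only [offspringProb]; fun_prop
  | 1 => simp only [offspringProb]; fun_prop
  | n + 2 => simp only [offspringProb]; fun_prop

end Offspring

/-! ### Forward rates and their generating function. -/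

/-- The right-hand side of the `m`-th Kolmogorov forward equation, for the death rate `l` and the
offspring distribution `q`, at the distribution `p`. -/
noncomputable def forwardRate (l : ℝ) (q p : ℕ → ℝ) (m : ℕ) : ℝ :=
  l * (∑ j ∈ Finset.range (m + 1), ((j : ℝ) + 1) * p (j + 1) * q (m - j) - m * p m)

section ForwardRate

variable {l r x : ℝ} {q p : ℕ → ℝ}

/-- Polynomial growth in `m` suffices: the rates are later summed against $r^m$ with $r<1$. The
factor `l` makes the bound integrable in time. -/
theorem abs_forwardRate_le (hl : 0 ≤ l) (hq0 : ∀ k, 0 ≤ q k) (hq1 : ∀ k, q k ≤ 1)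
    (hp0 : ∀ k, 0 ≤ p k) (hp1 : ∀ k, p k ≤ 1) (m : ℕ) :
    |forwardRate l q p m| ≤ l * ((m : ℝ) + 1) ^ 2 := by
  have h1 : 0 ≤ ∑ j ∈ Finset.range (m + 1), ((j : ℝ) + 1) * p (j + 1) * q (m - j) :=
    Finset.sum_nonneg fun j _ => mul_nonneg (mul_nonneg (by positivity) (hp0 _)) (hq0 _)
  have h2 : ∑ j ∈ Finset.range (m + 1), ((j : ℝ) + 1) * p (j + 1) * q (m - j) ≤
      ((m : ℝ) + 1) ^ 2 := by
    have : ∑ j ∈ Finset.range (m + 1), ((j : ℝ) + 1) * p (j + 1) * q (m - j) ≤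
        ∑ _j ∈ Finset.range (m + 1), ((m : ℝ) + 1) := by
      refine Finset.sum_le_sum fun j hj => ?_
      have hjm : (j : ℝ) ≤ m := by exact_mod_cast Nat.lt_succ_iff.1 (Finset.mem_range.1 hj)
      calc ((j : ℝ) + 1) * p (j + 1) * q (m - j) ≤ ((m : ℝ) + 1) * 1 * 1 := by
            gcongr
            exacts [hq0 _, hp0 _, hp1 _, hq1 _]
        _ = m + 1 := by ring
    refine this.trans_eq ?_
    simp
    ring
  have h3 : 0 ≤ (m : ℝ) * p m := mul_nonneg (by positivity) (hp0 m)
  have h4 : (m : ℝ) * p m ≤ ((m : ℝ) + 1) ^ 2 := by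
    have hm : (0 : ℝ) ≤ m := by positivity
    have : (m : ℝ) * p m ≤ m * 1 := by gcongr; exact hp1 m
    nlinarith
  rw [forwardRate, abs_mul, abs_of_nonneg hl]
  refine mul_le_mul_of_nonneg_left ?_ hl
  rw [abs_le]
  constructor <;> linarith

theorem summable_succ_mul_pow (hr0 : 0 ≤ r) (hr1 : r < 1) :
    Summable fun n : ℕ => ((n : ℝ) + 1) * r ^ n := by
  have hr : ‖r‖ < 1 := by rwa [Real.norm_of_nonneg hr0]
  refine ((summable_pow_mul_geometric_of_norm_lt_one 1 hr).add
    (summable_geometric_of_norm_lt_one hr)).congr fun n => ?_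
  ring

theorem summable_mul_pow_sub_one (hr0 : 0 ≤ r) (hr1 : r < 1) :
    Summable fun n : ℕ => (n : ℝ) * r ^ (n - 1) := by
  rw [← summable_nat_add_iff 1]
  simpa using summable_succ_mul_pow hr0 hr1

theorem summable_succ_sq_mul_pow (hr0 : 0 ≤ r) (hr1 : r < 1) :
    Summable fun n : ℕ => ((n : ℝ) + 1) ^ 2 * r ^ n := by
  have hr : ‖r‖ < 1 := by rwa [Real.norm_of_nonneg hr0]
  refine (((summable_pow_mul_geometric_of_norm_lt_one 2 hr).add
    ((summable_pow_mul_geometric_of_norm_lt_one 1 hr).mul_left 2)).add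
    (summable_geometric_of_norm_lt_one hr)).congr fun n => ?_
  ring

/-- The forward equations, summed against the powers of `x`. -/
theorem hasSum_forwardRate_mul_pow (hp0 : ∀ k, 0 ≤ p k)
    (hp1 : ∀ k, p k ≤ 1) (hx0 : 0 ≤ x) (hx1 : x < 1) {h : ℝ}
    (hh : HasSum (fun k => q k * x ^ k) h) :
    HasSum (fun m : ℕ => forwardRate l q p m * x ^ m +
      p m * ((m : ℝ) * x ^ (m - 1) * (-l * (h - x)))) 0 := by
  have hs : Summable fun j : ℕ => ((j : ℝ) + 1) * p (j + 1) * x ^ j := by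
    refine Summable.of_nonneg_of_le
      (fun j => mul_nonneg (mul_nonneg (by positivity) (hp0 _)) (pow_nonneg hx0 j)) (fun j => ?_)
      (summable_succ_mul_pow hx0 hx1)
    gcongr
    have : (0 : ℝ) ≤ (j : ℝ) + 1 := by positivity
    nlinarith [hp1 (j + 1)]
  -- `S` is the derivative at `x` of the generating function of `p`.
  obtain ⟨S, hS⟩ := hs
  have h1 : HasSum (fun m : ℕ => p m * ((m : ℝ) * x ^ (m - 1))) S := by
    rw [← hasSum_nat_add_iff' 1]
    simp only [Finset.range_one, Finset.sum_singleton, Nat.cast_zero, zero_mul, mul_zero, sub_zero]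
    refine hS.congr_fun fun j => ?_
    simp only [Nat.add_sub_cancel]
    push_cast
    ring
  have h2 : HasSum (fun m : ℕ => (m : ℝ) * p m * x ^ m) (x * S) := by
    refine (h1.mul_left x).congr_fun fun m => ?_
    rcases m with _ | m
    · simp
    · simp only [Nat.add_sub_cancel]
      ring
  -- The gain term is a convolution, so its generating function is the Cauchy product $S\,h$.
  have h3 : HasSum (fun m : ℕ => (∑ j ∈ Finset.range (m + 1),
      ((j : ℝ) + 1) * p (j + 1) * q (m - j)) * x ^ m) (S * h) := by
    have := hasSum_sum_range_mul_of_summable_norm hS.summable.norm hh.summable.norm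
    rw [hS.tsum_eq, hh.tsum_eq] at this
    refine this.congr_fun fun m => ?_
    rw [Finset.sum_mul]
    refine Finset.sum_congr rfl fun j hj => ?_
    have hjm : j + (m - j) = m := Nat.add_sub_cancel' (Nat.lt_succ_iff.1 (Finset.mem_range.1 hj))
    conv_lhs => rw [← hjm, pow_add, hjm]
    ring
  have h4 := ((h3.sub h2).mul_left l).add (h1.mul_right (-l * (h - x)))
  -- The forward motion of `p` contributes $lS(h-x)$, the backward motion of `x` its opposite.
  have e : l * (S * h - x * S) + S * (-l * (h - x)) = 0 := by ring
  rw [e] at h4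
  refine h4.congr_fun fun m => ?_
  rw [forwardRate]
  ring

end ForwardRate

end ThetaBranching

/-! ### Duality between the forward and backward equations. -/

namespace ThetaBranching

/-- If `p` solves the Kolmogorov forward equations started from one individual, and `φ` solves the
backward equation, then `∑ p_m(u) φ(u)^m` takes the same value at `0` and at `T`. -/
theorem hasSum_mul_pow_of_forward {θ : ℝ} (hθ0 : 0 < θ) (hθ1 : θ ≤ 1) {lam a : ℝ → ℝ} {T : ℝ}
    (hT : 0 ≤ T) (hlam : ∀ u ∈ Set.Icc 0 T, 0 ≤ lam u)
    (hlam_int : IntervalIntegrable lam volume 0 T)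
    (ha : ∀ u ∈ Set.Icc 0 T, 0 ≤ a u ∧ a u ≤ 1 + 1 / θ) {p : ℕ → ℝ → ℝ}
    (hp0 : ∀ m u, 0 ≤ p m u) (hp1 : ∀ m u, p m u ≤ 1)
    (hint : ∀ m, IntervalIntegrable
      (fun v => forwardRate (lam v) (offspringProb θ (a v)) (fun n => p n v) m) volume 0 T)
    (hfwd : ∀ m, ∀ u ∈ Set.Icc 0 T, p m u = (if m = 1 then 1 else 0) +
      ∫ v in (0 : ℝ)..u, forwardRate (lam v) (offspringProb θ (a v)) (fun n => p n v) m)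
    {φ : ℝ → ℝ} {r : ℝ} (hr : r < 1) (hφ_ac : AbsolutelyContinuousOnInterval φ 0 T)
    (hφ : ∀ᵐ u, u ∈ Set.uIcc 0 T →
      HasDerivAt φ (-lam u * (offspringPGF θ (a u) (φ u) - φ u)) u)
    (hφ0 : ∀ u ∈ Set.Icc 0 T, 0 ≤ φ u) (hφr : ∀ u ∈ Set.Icc 0 T, φ u ≤ r) :
    HasSum (fun m => p m T * φ T ^ m) (φ 0) := by
  have hI : Set.uIcc 0 T = Set.Icc 0 T := Set.uIcc_of_le hT
  have hr0 : 0 ≤ r := (hφ0 0 ⟨le_rfl, hT⟩).trans (hφr 0 ⟨le_rfl, hT⟩)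
  set rate : ℕ → ℝ → ℝ := fun m v =>
    forwardRate (lam v) (offspringProb θ (a v)) (fun n => p n v) m with hrate
  -- On `[0, T]` this is $p_m\varphi^m$; with $p_m$ written as its integral equation, absolute
  -- continuity is visible. `F m` is the almost everywhere derivative.
  set Q : ℕ → ℝ → ℝ := fun m u =>
    ((if m = 1 then 1 else 0) + ∫ v in (0 : ℝ)..u, rate m v) * φ u ^ m with hQ
  set F : ℕ → ℝ → ℝ := fun m u => rate m u * φ u ^ m +
    p m u * ((m : ℝ) * φ u ^ (m - 1) * (-lam u * (offspringPGF θ (a u) (φ u) - φ u))) with hF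
  have hQ_ac : ∀ m, AbsolutelyContinuousOnInterval (Q m) 0 T := fun m =>
    ((AbsolutelyContinuousOnInterval.const _ 0 T).add
      ((hint m).absolutelyContinuousOnInterval_intervalIntegral (by simp))).mul (hφ_ac.pow m)
  have hQ_deriv : ∀ m, ∀ᵐ u, u ∈ Set.uIcc 0 T → HasDerivAt (Q m) (F m u) u := by
    intro m
    filter_upwards [(hint m).ae_hasDerivAt_integral, hφ] with u h1 h2 hu
    have h3 := ((h1 hu 0 (by simp)).const_add (if m = 1 then (1 : ℝ) else 0)).mul
      ((h2 hu).pow m)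
    rw [← hfwd m u (hI ▸ hu)] at h3
    exact h3
  have hQ_int : ∀ m, ∫ u in (0 : ℝ)..T, F m u = Q m T - Q m 0 := fun m =>
    (hQ_ac m).integral_eq_sub_of_ae_hasDerivAt (hQ_deriv m)
  -- The bound $\varphi\le r<1$ enters here: it dominates the derivatives by a geometric-type
  -- series, so the sum and the time integral can be exchanged.
  have hb : Summable fun m : ℕ => ((m : ℝ) + 1) ^ 2 * r ^ m + (m : ℝ) * r ^ (m - 1) :=
    (summable_succ_sq_mul_pow hr0 hr).add (summable_mul_pow_sub_one hr0 hr)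
  have hsum : HasSum (fun m => ∫ u in (0 : ℝ)..T, F m u) (∫ _u in (0 : ℝ)..T, (0 : ℝ)) := by
    refine intervalIntegral.hasSum_integral_of_dominated_convergence
      (fun m u => lam u * (((m : ℝ) + 1) ^ 2 * r ^ m + (m : ℝ) * r ^ (m - 1))) ?_ ?_ ?_ ?_ ?_
    · intro m
      -- `F m` agrees almost everywhere with `deriv (Q m)`, and a derivative is always measurable.
      refine (measurable_deriv (Q m)).aestronglyMeasurable.congr ?_
      rw [Filter.EventuallyEq, ae_restrict_iff' measurableSet_uIoc]
      filter_upwards [hQ_deriv m] with u h hu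
      exact (h (Set.uIoc_subset_uIcc hu)).deriv
    · intro m
      refine Filter.Eventually.of_forall fun u hu => ?_
      have huI : u ∈ Set.Icc 0 T := hI ▸ Set.uIoc_subset_uIcc hu
      have hl := hlam u huI
      obtain ⟨ha0, ha1⟩ := ha u huI
      have hx0 := hφ0 u huI
      have hxr := hφr u huI
      have hh0 := offspringPGF_nonneg hθ0 hθ1 ha0 ha1 hx0 (hxr.trans_lt hr)
      have hh1 := offspringPGF_le_one (a := a u) hθ0 ha0 hx0 (hxr.trans hr.le)
      have hd : |offspringPGF θ (a u) (φ u) - φ u| ≤ 1 := by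
        rw [abs_le]; constructor <;> linarith
      rw [mul_add]
      refine (norm_add_le _ _).trans (add_le_add ?_ ?_)
      · rw [Real.norm_eq_abs, abs_mul, abs_of_nonneg (pow_nonneg hx0 m), ← mul_assoc]
        gcongr
        exact abs_forwardRate_le hl (offspringProb_nonneg hθ0 hθ1 ha0 ha1)
          (offspringProb_le_one hθ0 hθ1 ha0 ha1) (fun k => hp0 k u) (fun k => hp1 k u) m
      · rw [Real.norm_eq_abs, abs_mul, abs_of_nonneg (hp0 m u), abs_mul, abs_mul, abs_mul,
          abs_neg, abs_of_nonneg hl, abs_of_nonneg (pow_nonneg hx0 _), Nat.abs_cast]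
        calc p m u * ((m : ℝ) * φ u ^ (m - 1) *
              (lam u * |offspringPGF θ (a u) (φ u) - φ u|))
            ≤ 1 * ((m : ℝ) * r ^ (m - 1) * (lam u * 1)) := by
              gcongr
              exact hp1 m u
          _ = lam u * ((m : ℝ) * r ^ (m - 1)) := by ring
    · exact Filter.Eventually.of_forall fun u _ => hb.mul_left _
    · simp only [tsum_mul_left]
      exact hlam_int.mul_const _
    · refine Filter.Eventually.of_forall fun u hu => ?_
      have huI : u ∈ Set.Icc 0 T := hI ▸ Set.uIoc_subset_uIcc hu
      exact hasSum_forwardRate_mul_pow (fun k => hp0 k u) (fun k => hp1 k u) (hφ0 u huI)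
        ((hφr u huI).trans_lt hr)
        (hasSum_offspringProb hθ0 (a u) (hφ0 u huI) ((hφr u huI).trans_lt hr))
  simp only [hQ_int, intervalIntegral.integral_zero] at hsum
  -- At time 0 there is one individual, so only `m = 1` contributes.
  have h0 : HasSum (fun m => Q m 0) (φ 0) := by
    have := hasSum_ite_eq 1 (φ 0)
    refine this.congr_fun fun m => ?_
    by_cases hm : m = 1 <;> simp [hQ, hm]
  have hfin := hsum.add h0
  rw [zero_add] at hfin
  refine hfin.congr_fun fun m => ?_
  rw [hfwd m T ⟨hT, le_rfl⟩]
  simp [hQ, hrate]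

/-! ### The mean and $V_{t,\theta}$ as functions of the environment. -/

/-- The mean of the branching population at time `t`, in terms of its environment. -/
noncomputable def envMean (lam a : ℝ → ℝ) (t : ℝ) : ℝ :=
  Real.exp (∫ u in (0 : ℝ)..t, lam u * (a u - 1))

/-- `V_{t,θ}` in terms of the environment. -/
noncomputable def envV (θ : ℝ) (lam a : ℝ → ℝ) (t : ℝ) : ℝ :=
  θ * (1 + θ)⁻¹ * ∫ u in (0 : ℝ)..t, envMean lam a u ^ (-θ) * lam u

section Environment

variable {θ : ℝ} {lam a : ℝ → ℝ} {T : ℝ}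

theorem envMean_pos (lam a : ℝ → ℝ) (t : ℝ) : 0 < envMean lam a t := Real.exp_pos _

@[simp] theorem envMean_zero (lam a : ℝ → ℝ) : envMean lam a 0 = 1 := by simp [envMean]

@[simp] theorem envV_zero (θ : ℝ) (lam a : ℝ → ℝ) : envV θ lam a 0 = 0 := by simp [envV]

theorem intervalIntegrable_mul_sub_one (hT : 0 ≤ T)
    (hlam_int : IntervalIntegrable lam volume 0 T) (ha_meas : Measurable a)
    (ha : ∀ u ∈ Set.Icc 0 T, 0 ≤ a u ∧ a u ≤ 1 + 1 / θ) :
    IntervalIntegrable (fun u => lam u * (a u - 1)) volume 0 T := by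
  rw [intervalIntegrable_iff] at hlam_int ⊢
  refine Integrable.mul_bdd (c := 1 + 1 / θ + 1) hlam_int
    (ha_meas.sub_const 1).aestronglyMeasurable ?_
  refine (ae_restrict_iff' measurableSet_uIoc).2 (Filter.Eventually.of_forall fun u hu => ?_)
  have h := ha u (Set.uIcc_of_le hT ▸ Set.uIoc_subset_uIcc hu)
  rw [Real.norm_eq_abs, abs_le]
  constructor <;> linarith [h.1, h.2, h.1.trans h.2]

theorem envMean_rpow (c : ℝ) (t : ℝ) :
    envMean lam a t ^ c = Real.exp ((∫ u in (0 : ℝ)..t, lam u * (a u - 1)) * c) :=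
  (Real.exp_mul _ _).symm

theorem absolutelyContinuousOnInterval_envMean_rpow
    (h : IntervalIntegrable (fun u => lam u * (a u - 1)) volume 0 T) (c : ℝ) :
    AbsolutelyContinuousOnInterval (fun t => envMean lam a t ^ c) 0 T := by
  simp only [envMean_rpow]
  exact (Real.contDiff_exp.comp (contDiff_id.mul contDiff_const)).comp_absolutelyContinuousOnInterval
    (h.absolutelyContinuousOnInterval_intervalIntegral (by simp))

theorem ae_hasDerivAt_envMean_rpow
    (h : IntervalIntegrable (fun u => lam u * (a u - 1)) volume 0 T) (c : ℝ) :
    ∀ᵐ u, u ∈ Set.uIcc 0 T → HasDerivAt (fun t => envMean lam a t ^ c)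
      (c * (lam u * (a u - 1)) * envMean lam a u ^ c) u := by
  filter_upwards [h.ae_hasDerivAt_integral] with u hu hm
  simp only [envMean_rpow]
  convert ((hu hm 0 (by simp)).mul_const c).exp using 1
  ring

theorem intervalIntegrable_envMean_rpow_mul (hlam_int : IntervalIntegrable lam volume 0 T)
    (h : IntervalIntegrable (fun u => lam u * (a u - 1)) volume 0 T) (c : ℝ) :
    IntervalIntegrable (fun u => envMean lam a u ^ c * lam u) volume 0 T :=
  hlam_int.continuousOn_mul (absolutelyContinuousOnInterval_envMean_rpow h c).continuousOn

theorem absolutelyContinuousOnInterval_envV (hlam_int : IntervalIntegrable lam volume 0 T)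
    (h : IntervalIntegrable (fun u => lam u * (a u - 1)) volume 0 T) :
    AbsolutelyContinuousOnInterval (envV θ lam a) 0 T :=
  ((intervalIntegrable_envMean_rpow_mul hlam_int h
    (-θ)).absolutelyContinuousOnInterval_intervalIntegral (by simp)).const_mul _

theorem ae_hasDerivAt_envV (hlam_int : IntervalIntegrable lam volume 0 T)
    (h : IntervalIntegrable (fun u => lam u * (a u - 1)) volume 0 T) :
    ∀ᵐ u, u ∈ Set.uIcc 0 T → HasDerivAt (envV θ lam a)
      (θ * (1 + θ)⁻¹ * (envMean lam a u ^ (-θ) * lam u)) u := by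
  filter_upwards [(intervalIntegrable_envMean_rpow_mul hlam_int h (-θ)).ae_hasDerivAt_integral]
    with u hu hm
  exact (hu hm 0 (by simp)).const_mul _

theorem envV_nonneg (hθ0 : 0 < θ) (hT : 0 ≤ T) (hlam : ∀ u ∈ Set.Icc 0 T, 0 ≤ lam u) :
    0 ≤ envV θ lam a T := by
  refine mul_nonneg (by positivity) (intervalIntegral.integral_nonneg hT fun u hu => ?_)
  exact mul_nonneg (Real.rpow_nonneg (envMean_pos _ _ _).le _) (hlam u hu)

/-- `V_t + c μ_t^{-θ}` is monotone in `t` if `c` is such that its derivative is nonnegative. -/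
theorem envV_add_mul_le {c u : ℝ} (hu : u ∈ Set.Icc 0 T)
    (hlam : ∀ u ∈ Set.Icc 0 T, 0 ≤ lam u)
    (hlam_int : IntervalIntegrable lam volume 0 T)
    (h : IntervalIntegrable (fun u => lam u * (a u - 1)) volume 0 T)
    (hc : ∀ v ∈ Set.Icc 0 T, 0 ≤ θ * (1 + θ)⁻¹ - c * θ * (a v - 1)) :
    envV θ lam a u + c * envMean lam a u ^ (-θ) ≤
      envV θ lam a T + c * envMean lam a T ^ (-θ) := by
  have hsub : Set.uIcc u T ⊆ Set.uIcc 0 T := by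
    rw [Set.uIcc_of_le hu.2, Set.uIcc_of_le (hu.1.trans hu.2)]
    exact Set.Icc_subset_Icc_left hu.1
  refine AbsolutelyContinuousOnInterval.le_of_ae_hasDerivAt_nonneg
    (f := fun t => envV θ lam a t + c * envMean lam a t ^ (-θ))
    (f' := fun v => lam v * envMean lam a v ^ (-θ) * (θ * (1 + θ)⁻¹ - c * θ * (a v - 1))) hu.2
    (((absolutelyContinuousOnInterval_envV hlam_int h).add
    ((absolutelyContinuousOnInterval_envMean_rpow h (-θ)).const_mul c)).mono hsub) ?_ ?_
  · filter_upwards [ae_hasDerivAt_envV hlam_int h, ae_hasDerivAt_envMean_rpow h (-θ)]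
      with v h1 h2 hv
    convert! (h1 (hsub hv)).add ((h2 (hsub hv)).const_mul c) using 1
    ring
  · intro v hv
    have hv' : v ∈ Set.Icc 0 T := ⟨hu.1.trans hv.1, hv.2⟩
    exact mul_nonneg (mul_nonneg (hlam v hv') (Real.rpow_nonneg (envMean_pos _ _ _).le _))
      (hc v hv')

end Environment

end ThetaBranching

/-! ### Explicit solution of the backward equation. -/

namespace ThetaBranching

section BackwardEquation

variable {θ s : ℝ} {lam a : ℝ → ℝ} {T : ℝ}

/-- The function `W` for which `1 - W^{-1/θ}` is the solution of the backward equation on `[0, T]`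
with the value `s` at `T`. -/
noncomputable def backwardW (θ : ℝ) (lam a : ℝ → ℝ) (T s u : ℝ) : ℝ :=
  (1 + θ)⁻¹ + envMean lam a u ^ θ *
    (envMean lam a T ^ (-θ) * ((1 - s) ^ (-θ) - (1 + θ)⁻¹) + envV θ lam a T - envV θ lam a u)

theorem backwardW_zero : backwardW θ lam a T s 0 =
    envMean lam a T ^ (-θ) * ((1 - s) ^ (-θ) - (1 + θ)⁻¹) + envV θ lam a T + (1 + θ)⁻¹ := by
  simp [backwardW]
  ring

theorem envMean_rpow_mul_rpow_neg (θ : ℝ) (lam a : ℝ → ℝ) (u : ℝ) :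
    envMean lam a u ^ θ * envMean lam a u ^ (-θ) = 1 := by
  rw [← Real.rpow_add (envMean_pos _ _ _), add_neg_cancel, Real.rpow_zero]

theorem backwardW_self : backwardW θ lam a T s T = (1 - s) ^ (-θ) := by
  have := envMean_rpow_mul_rpow_neg θ lam a T
  rw [backwardW]
  linear_combination ((1 - s) ^ (-θ) - (1 + θ)⁻¹) * this

/-- This keeps $1-W^{-1/\theta}$ in $[0,1)$. It holds because
$V_u+\frac{\theta}{1+\theta}\mu_u^{-\theta}$ is nondecreasing when $a\le1+1/\theta$. -/
theorem one_le_backwardW (hθ0 : 0 < θ) (hlam : ∀ u ∈ Set.Icc 0 T, 0 ≤ lam u)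
    (hlam_int : IntervalIntegrable lam volume 0 T)
    (h : IntervalIntegrable (fun u => lam u * (a u - 1)) volume 0 T)
    (ha : ∀ u ∈ Set.Icc 0 T, 0 ≤ a u ∧ a u ≤ 1 + 1 / θ) (hs0 : 0 ≤ s) (hs1 : s < 1)
    {u : ℝ} (hu : u ∈ Set.Icc 0 T) : 1 ≤ backwardW θ lam a T s u := by
  have h1 : (1 : ℝ) ≤ (1 - s) ^ (-θ) :=
    Real.one_le_rpow_of_pos_of_le_one_of_nonpos (by linarith) (by linarith) (by linarith)
  -- With this `c` the sign condition is $1-\theta(a-1)\ge0$, and $\frac1{1+\theta}+c=1$ is the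
  -- required lower bound.
  have h2 := envV_add_mul_le (θ := θ) (c := θ * (1 + θ)⁻¹) hu hlam hlam_int h (by
    intro v hv
    have h3 : θ * (a v - 1) ≤ θ * (1 / θ) := by
      gcongr
      linarith [(ha v hv).2]
    have h4 : θ * (1 / θ) = 1 := by field_simp
    have h5 : 0 ≤ θ * (1 + θ)⁻¹ := by positivity
    nlinarith)
  have h3 : 0 ≤ envMean lam a T ^ (-θ) * ((1 - s) ^ (-θ) - 1) :=
    mul_nonneg (Real.rpow_nonneg (envMean_pos _ _ _).le _) (by linarith)
  have h4 := envMean_rpow_mul_rpow_neg θ lam a u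
  have h5 : 0 < envMean lam a u ^ θ := Real.rpow_pos_of_pos (envMean_pos _ _ _) _
  have h6 : (1 + θ)⁻¹ + θ * (1 + θ)⁻¹ = 1 := by field_simp
  have h7 : θ * (1 + θ)⁻¹ * envMean lam a u ^ (-θ) ≤
      envMean lam a T ^ (-θ) * ((1 - s) ^ (-θ) - (1 + θ)⁻¹) + envV θ lam a T - envV θ lam a u := by
    have : envMean lam a T ^ (-θ) * ((1 - s) ^ (-θ) - (1 + θ)⁻¹) =
        envMean lam a T ^ (-θ) * ((1 - s) ^ (-θ) - 1) +
          θ * (1 + θ)⁻¹ * envMean lam a T ^ (-θ) := by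
      linear_combination (-envMean lam a T ^ (-θ)) * h6
    linarith
  have h8 := mul_le_mul_of_nonneg_left h7 h5.le
  rw [backwardW]
  have h9 : envMean lam a u ^ θ * (θ * (1 + θ)⁻¹ * envMean lam a u ^ (-θ)) = θ * (1 + θ)⁻¹ := by
    linear_combination (θ * (1 + θ)⁻¹) * h4
  linarith

theorem absolutelyContinuousOnInterval_backwardW
    (hlam_int : IntervalIntegrable lam volume 0 T)
    (h : IntervalIntegrable (fun u => lam u * (a u - 1)) volume 0 T) :
    AbsolutelyContinuousOnInterval (backwardW θ lam a T s) 0 T :=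
  (AbsolutelyContinuousOnInterval.const _ _ _).add
    ((absolutelyContinuousOnInterval_envMean_rpow h θ).mul
      ((AbsolutelyContinuousOnInterval.const _ _ _).sub
        (absolutelyContinuousOnInterval_envV hlam_int h)))

theorem ae_hasDerivAt_backwardW (hlam_int : IntervalIntegrable lam volume 0 T)
    (h : IntervalIntegrable (fun u => lam u * (a u - 1)) volume 0 T) :
    ∀ᵐ u, u ∈ Set.uIcc 0 T → HasDerivAt (backwardW θ lam a T s)
      (θ * lam u * ((a u - 1) * (backwardW θ lam a T s u - (1 + θ)⁻¹) - (1 + θ)⁻¹)) u := by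
  filter_upwards [ae_hasDerivAt_envV (θ := θ) hlam_int h, ae_hasDerivAt_envMean_rpow h θ]
    with u h1 h2 hu
  have h3 := ((h2 hu).mul ((h1 hu).const_sub (envMean lam a T ^ (-θ) *
    ((1 - s) ^ (-θ) - (1 + θ)⁻¹) + envV θ lam a T))).const_add (1 + θ)⁻¹
  refine h3.congr_deriv ?_
  simp only [backwardW]
  linear_combination (-(θ * (1 + θ)⁻¹ * lam u)) * envMean_rpow_mul_rpow_neg θ lam a u

/-- Undoes the Bernoulli substitution: with $y=W^{-1/\theta}$, the linear equation for $W$ becomes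
$y'=\lambda\big((1-a)y+\frac{a}{1+\theta}y^{1+\theta}\big)$. -/
theorem hasDerivAt_one_sub_backwardW_rpow (hθ0 : 0 < θ) {u : ℝ}
    (hW : 0 < backwardW θ lam a T s u)
    (hd : HasDerivAt (backwardW θ lam a T s)
      (θ * lam u * ((a u - 1) * (backwardW θ lam a T s u - (1 + θ)⁻¹) - (1 + θ)⁻¹)) u) :
    HasDerivAt (fun u => 1 - backwardW θ lam a T s u ^ (-1 / θ))
      (-lam u * (offspringPGF θ (a u) (1 - backwardW θ lam a T s u ^ (-1 / θ)) -
        (1 - backwardW θ lam a T s u ^ (-1 / θ)))) u := by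
  refine ((hd.rpow_const (p := -1 / θ) (Or.inl hW.ne')).const_sub 1).congr_deriv ?_
  set W := backwardW θ lam a T s u
  have e1 : (W ^ (-1 / θ)) ^ (1 + θ) = W ^ (-1 / θ - 1) := by
    rw [← Real.rpow_mul hW.le]
    congr 1
    field_simp
    ring
  have e2 : W ^ (-1 / θ) = W * W ^ (-1 / θ - 1) := by
    rw [Real.rpow_sub hW, Real.rpow_one]
    field_simp
  simp only [offspringPGF, sub_sub_cancel]
  rw [e1, e2]
  field_simp
  ring

/-- The generating function of the solution of the Kolmogorov forward equations started from one
individual. -/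
theorem hasSum_pgf_of_forward (hθ0 : 0 < θ) (hθ1 : θ ≤ 1)
    (hT : 0 ≤ T) (hlam : ∀ u ∈ Set.Icc 0 T, 0 ≤ lam u)
    (hlam_int : IntervalIntegrable lam volume 0 T) (ha_meas : Measurable a)
    (ha : ∀ u ∈ Set.Icc 0 T, 0 ≤ a u ∧ a u ≤ 1 + 1 / θ) {p : ℕ → ℝ → ℝ}
    (hp0 : ∀ m u, 0 ≤ p m u) (hp1 : ∀ m u, p m u ≤ 1)
    (hint : ∀ m, IntervalIntegrable
      (fun v => forwardRate (lam v) (offspringProb θ (a v)) (fun n => p n v) m) volume 0 T)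
    (hfwd : ∀ m, ∀ u ∈ Set.Icc 0 T, p m u = (if m = 1 then 1 else 0) +
      ∫ v in (0 : ℝ)..u, forwardRate (lam v) (offspringProb θ (a v)) (fun n => p n v) m)
    (hs0 : 0 ≤ s) (hs1 : s < 1) :
    HasSum (fun m => p m T * s ^ m) (1 - (envMean lam a T ^ (-θ) *
      ((1 - s) ^ (-θ) - (1 + θ)⁻¹) + envV θ lam a T + (1 + θ)⁻¹) ^ (-1 / θ)) := by
  have h := intervalIntegrable_mul_sub_one hT hlam_int ha_meas ha
  have hI : Set.uIcc 0 T = Set.Icc 0 T := Set.uIcc_of_le hT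
  have hW1 : ∀ u ∈ Set.Icc 0 T, 1 ≤ backwardW θ lam a T s u := fun u hu =>
    one_le_backwardW hθ0 hlam hlam_int h ha hs0 hs1 hu
  have hW_ac := absolutelyContinuousOnInterval_backwardW (θ := θ) (s := s) hlam_int h
  -- An upper bound for $W$ keeps $\varphi$ uniformly away from 1; it supplies the ratio
  -- $r=1-B^{-1/\theta}$.
  obtain ⟨B, hB⟩ := hW_ac.exists_bound
  have hWB : ∀ u ∈ Set.Icc 0 T, backwardW θ lam a T s u ≤ B := fun u hu =>
    (le_abs_self _).trans (hB u (hI ▸ hu))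
  have hB0 : 0 < B := zero_lt_one.trans_le ((hW1 0 ⟨le_rfl, hT⟩).trans (hWB 0 ⟨le_rfl, hT⟩))
  have hexp : -1 / θ ≤ 0 := div_nonpos_of_nonpos_of_nonneg (by norm_num) hθ0.le
  have key := hasSum_mul_pow_of_forward (φ := fun u => 1 - backwardW θ lam a T s u ^ (-1 / θ))
    (r := 1 - B ^ (-1 / θ)) hθ0 hθ1 hT hlam hlam_int ha hp0 hp1 hint hfwd
    (by linarith [Real.rpow_pos_of_pos hB0 (-1 / θ)]) ?_ ?_ ?_ ?_
  · simp only [backwardW_zero, backwardW_self] at key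
    have e : ((1 - s) ^ (-θ)) ^ (-1 / θ) = 1 - s := by
      rw [← Real.rpow_mul (by linarith)]
      have : -θ * (-1 / θ) = 1 := by field_simp
      rw [this, Real.rpow_one]
    simpa only [e, sub_sub_cancel] using key
  · refine ContDiffOn.comp_absolutelyContinuousOnInterval (g := fun x : ℝ => 1 - x ^ (-1 / θ))
      (c := 1) (d := B) ?_ hW_ac fun u hu => ⟨hW1 u (hI ▸ hu), hWB u (hI ▸ hu)⟩
    exact contDiffOn_const.sub (contDiffOn_id.rpow_const_of_ne fun x hx =>
      (zero_lt_one.trans_le hx.1).ne')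
  · filter_upwards [ae_hasDerivAt_backwardW (θ := θ) (s := s) hlam_int h] with u hd hu
    exact hasDerivAt_one_sub_backwardW_rpow hθ0 (zero_lt_one.trans_le (hW1 u (hI ▸ hu))) (hd hu)
  · intro u hu
    have := Real.rpow_le_one_of_one_le_of_nonpos (hW1 u hu) hexp
    simpa using this
  · intro u hu
    have := Real.rpow_le_rpow_of_nonpos (zero_lt_one.trans_le (hW1 u hu)) (hWB u hu) hexp
    linarith

end BackwardEquation

end ThetaBranching

/-! ### From the martingale problem to the forward equations. -/

/-- A process indexed by `ℝ≥0` with right-continuous paths is jointly measurable. -/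
theorem measurable_uncurry_of_rightContinuous {Ω E : Type*} [MeasurableSpace Ω]
    [TopologicalSpace E] [TopologicalSpace.PseudoMetrizableSpace E] [MeasurableSpace E]
    [BorelSpace E] {X : ℝ≥0 → Ω → E} (hX : ∀ t, Measurable (X t))
    (hc : ∀ ω t, ContinuousWithinAt (fun r => X r ω) (Set.Ici t) t) :
    Measurable fun x : ℝ≥0 × Ω => X x.1 x.2 := by
  have key : ∀ (c : ℕ → ℝ≥0) (g : ℝ≥0 → ℕ), Measurable g →
      Measurable fun x : ℝ≥0 × Ω => X (c (g x.1)) x.2 := fun c g hg => by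
    have h1 : Measurable fun y : ℕ × Ω => X (c y.1) y.2 :=
      measurable_from_prod_countable_right fun j => hX (c j)
    exact h1.comp ((hg.comp measurable_fst).prodMk measurable_snd)
  -- The first multiple of $1/(k+1)$ strictly above `u`: it takes countably many values and
  -- decreases to `u` only in the limit from the right, where the paths are continuous.
  set d : ℕ → ℝ≥0 → ℝ≥0 := fun k u => ((⌊u * ((k : ℝ≥0) + 1)⌋₊ : ℝ≥0) + 1) / ((k : ℝ≥0) + 1)
    with hd
  have hk : ∀ k : ℕ, (0 : ℝ≥0) < (k : ℝ≥0) + 1 := fun k => by positivity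
  have hd_ge : ∀ k u, u ≤ d k u := fun k u => by
    rw [hd, le_div_iff₀ (hk k)]
    exact (Nat.lt_floor_add_one _).le
  have hd_le : ∀ k u, d k u ≤ u + 1 / ((k : ℝ≥0) + 1) := fun k u => by
    rw [hd, div_le_iff₀ (hk k), add_mul, one_div, inv_mul_cancel₀ (hk k).ne']
    gcongr
    exact Nat.floor_le (by positivity)
  have hd_tendsto : ∀ u, Tendsto (fun k => d k u) atTop (𝓝[≥] u) := fun u => by
    refine tendsto_nhdsWithin_iff.2 ⟨?_, Filter.Eventually.of_forall fun k => hd_ge k u⟩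
    refine tendsto_of_tendsto_of_tendsto_of_le_of_le tendsto_const_nhds ?_
      (fun k => hd_ge k u) (fun k => hd_le k u)
    simpa using (tendsto_const_nhds (x := u)).add
      (tendsto_one_div_add_atTop_nhds_zero_nat (𝕜 := ℝ≥0))
  refine measurable_of_tendsto_metrizable (f := fun (k : ℕ) (x : ℝ≥0 × Ω) => X (d k x.1) x.2)
    (fun k => ?_) ?_
  · exact key (fun j => ((j : ℝ≥0) + 1) / ((k : ℝ≥0) + 1)) (fun u => ⌊u * ((k : ℝ≥0) + 1)⌋₊)
      (Nat.measurable_floor.comp (measurable_id.mul_const _))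
  · rw [tendsto_pi_nhds]
    exact fun x => (hc x.2 x.1).tendsto.comp (hd_tendsto x.1)

namespace ThetaBranching

/-- The generator on the indicator function of `m`. -/
theorem generator_indicator (θ : ℝ) (lam a : ℝ → ℝ) (m : ℕ) (u : ℝ) (z : ℕ) :
    generator θ lam a (fun n => if n = m then 1 else 0) u z =
      forwardRate (lam u) (offspringProb θ (a u)) (fun n => if z = n then 1 else 0) m := by
  rcases z with _ | j
  -- In an empty population the factor `n` vanishes, so the truncated `n - 1` is harmless.
  · have : 0 = m → lam u = 0 ∨ m = 0 := fun h => Or.inr h.symm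
    simpa [generator, forwardRate] using this
  -- From `j + 1` individuals, a death with `k` offspring leads to `j + k`, which is `m` only for `k
  -- = m - j`.
  · have h1 : ∑' k : ℕ, offspringProb θ (a u) k * (if j + k = m then (1 : ℝ) else 0) =
        if j < m + 1 then offspringProb θ (a u) (m - j) else 0 := by
      split_ifs with hj
      · rw [tsum_eq_single (m - j)]
        · rw [if_pos (by omega), mul_one]
        · intro k hk
          rw [if_neg (by omega), mul_zero]
      · have h0 : ∀ k : ℕ, offspringProb θ (a u) k * (if j + k = m then (1 : ℝ) else 0) = 0 :=
          fun k => by rw [if_neg (by omega), mul_zero]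
        simp only [h0, tsum_zero]
    have h2 : ∑ i ∈ Finset.range (m + 1), ((i : ℝ) + 1) * (if j + 1 = i + 1 then (1 : ℝ) else 0) *
        offspringProb θ (a u) (m - i) =
        if j < m + 1 then ((j : ℝ) + 1) * offspringProb θ (a u) (m - j) else 0 := by
      simp [Finset.sum_ite_eq]
    simp only [generator, forwardRate, Nat.add_sub_cancel]
    rw [h1, h2]
    by_cases hm : j + 1 = m
    · subst hm
      simp
      ring
    · split_ifs <;> push_cast <;> ring

variable {Ω : Type*} [mΩ : MeasurableSpace Ω] {P : Measure Ω} {ℱ : Filtration ℝ≥0 mΩ}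
  {θ : ℝ} {lam a : ℝ → ℝ} {Z : ℝ≥0 → Ω → ℕ}

theorem IsThetaPositiveBranchingProcess.measurable
    (hZ : IsThetaPositiveBranchingProcess P ℱ θ lam a Z) (t : ℝ≥0) : Measurable (Z t) :=
  (hZ.adapted t).mono (ℱ.le t) le_rfl

/-- The probability that the population size is `n` at time `u`. -/
noncomputable def sizeProb (P : Measure Ω) (Z : ℝ≥0 → Ω → ℕ) (n : ℕ) (u : ℝ) : ℝ :=
  P.real {ω | Z u.toNNReal ω = n}

theorem sizeProb_nonneg (P : Measure Ω) (Z : ℝ≥0 → Ω → ℕ) (n : ℕ) (u : ℝ) :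
    0 ≤ sizeProb P Z n u := measureReal_nonneg

theorem sizeProb_le_one [IsProbabilityMeasure P] (Z : ℝ≥0 → Ω → ℕ) (n : ℕ) (u : ℝ) :
    sizeProb P Z n u ≤ 1 := measureReal_le_one

theorem integral_indicator_eq_measureReal {X : Ω → ℕ} (hX : Measurable X) (n : ℕ) :
    ∫ ω, (if X ω = n then (1 : ℝ) else 0) ∂P = P.real {ω | X ω = n} := by
  have hs : MeasurableSet {ω | X ω = n} := hX (measurableSet_singleton n)
  rw [← integral_indicator_one hs]
  refine integral_congr_ae (Filter.Eventually.of_forall fun ω => ?_)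
  simp [Set.indicator_apply]

theorem integrable_ite_eq [IsFiniteMeasure P] {X : Ω → ℕ} (hX : Measurable X) (n : ℕ) :
    Integrable (fun ω => if X ω = n then (1 : ℝ) else 0) P := by
  refine Integrable.of_bound (C := 1) ?_ (Filter.Eventually.of_forall fun ω => ?_)
  · exact (Measurable.ite (hX (measurableSet_singleton n)) measurable_const
      measurable_const).aestronglyMeasurable
  · split_ifs <;> simp

/-- The forward rates at the law of `X` are the expected forward rates at the point masses. -/
theorem integral_forwardRate [IsFiniteMeasure P] {X : Ω → ℕ} (hX : Measurable X) (l : ℝ)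
    (q : ℕ → ℝ) (m : ℕ) :
    ∫ ω, forwardRate l q (fun n => if X ω = n then 1 else 0) m ∂P =
      forwardRate l q (fun n => P.real {ω | X ω = n}) m := by
  simp only [forwardRate, integral_const_mul]
  have hi := fun n => integrable_ite_eq (P := P) hX n
  rw [integral_sub (integrable_finsetSum _ fun j _ => ((hi _).const_mul _).mul_const _)
    ((hi m).const_mul _), integral_finsetSum _ fun j _ => ((hi _).const_mul _).mul_const _]
  simp only [integral_mul_const, integral_const_mul, integral_indicator_eq_measureReal hX]

section Forward

variable [IsProbabilityMeasure P]

/-- This licenses Fubini between expectation and time integral; right-continuity of the paths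
supplies the joint measurability. -/
theorem integrable_uncurry_forwardRate (hθ0 : 0 < θ) (hθ1 : θ ≤ 1) (hlam_meas : Measurable lam)
    (ha_meas : Measurable a) {T : ℝ} (hT : 0 ≤ T) (hlam : ∀ u ∈ Set.Icc 0 T, 0 ≤ lam u)
    (hlam_int : IntervalIntegrable lam volume 0 T)
    (ha : ∀ u ∈ Set.Icc 0 T, 0 ≤ a u ∧ a u ≤ 1 + 1 / θ)
    (hZ : IsThetaPositiveBranchingProcess P ℱ θ lam a Z) (m : ℕ) :
    Integrable (Function.uncurry fun (u : ℝ) (ω : Ω) =>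
      forwardRate (lam u) (offspringProb θ (a u)) (fun n => if Z u.toNNReal ω = n then 1 else 0) m)
      ((volume.restrict (Set.uIoc 0 T)).prod P) := by
  have hZm : Measurable fun x : ℝ × Ω => Z x.1.toNNReal x.2 :=
    (measurable_uncurry_of_rightContinuous hZ.measurable hZ.right_cont).comp
      ((measurable_real_toNNReal.comp measurable_fst).prodMk measurable_snd)
  have hite : ∀ n : ℕ, Measurable fun x : ℝ × Ω =>
      if Z x.1.toNNReal x.2 = n then (1 : ℝ) else 0 := fun n =>
    Measurable.ite (hZm (measurableSet_singleton n)) measurable_const measurable_const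
  have hq : ∀ k, Measurable fun x : ℝ × Ω => offspringProb θ (a x.1) k := fun k =>
    (measurable_offspringProb θ k).comp (ha_meas.comp measurable_fst)
  have hmeas : Measurable (Function.uncurry fun (u : ℝ) (ω : Ω) =>
      forwardRate (lam u) (offspringProb θ (a u))
        (fun n => if Z u.toNNReal ω = n then 1 else 0) m) := by
    simp only [forwardRate, Function.uncurry_def]
    refine (hlam_meas.comp measurable_fst).mul (Measurable.sub ?_ ((hite m).const_mul _))
    exact Finset.measurable_fun_sum _ fun j _ => ((hite _).const_mul _).mul (hq _)
  have hbound : Integrable (fun x : ℝ × Ω => lam x.1 * ((m : ℝ) + 1) ^ 2)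
      ((volume.restrict (Set.uIoc 0 T)).prod P) :=
    ((intervalIntegrable_iff.1 hlam_int).mul_const _).comp_fst P
  refine hbound.mono' hmeas.aestronglyMeasurable ?_
  have hae : ∀ᵐ x ∂((volume.restrict (Set.uIoc 0 T)).prod P), x.1 ∈ Set.uIoc 0 T :=
    Measure.quasiMeasurePreserving_fst.ae (ae_restrict_mem measurableSet_uIoc)
  filter_upwards [hae] with x hx
  have hxI : x.1 ∈ Set.Icc 0 T := Set.uIcc_of_le hT ▸ Set.uIoc_subset_uIcc hx
  obtain ⟨ha0, ha1⟩ := ha _ hxI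
  have h0 : ∀ k, (0 : ℝ) ≤ if Z x.1.toNNReal x.2 = k then 1 else 0 := fun k => by
    split_ifs <;> norm_num
  have h1 : ∀ k, (if Z x.1.toNNReal x.2 = k then (1 : ℝ) else 0) ≤ 1 := fun k => by
    split_ifs <;> norm_num
  rw [Function.uncurry_def, Real.norm_eq_abs]
  exact abs_forwardRate_le (hlam _ hxI) (offspringProb_nonneg hθ0 hθ1 ha0 ha1)
    (offspringProb_le_one hθ0 hθ1 ha0 ha1) h0 h1 m

theorem intervalIntegrable_forwardRate_sizeProb (hθ0 : 0 < θ) (hθ1 : θ ≤ 1)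
    (hlam_meas : Measurable lam) (ha_meas : Measurable a) {T : ℝ} (hT : 0 ≤ T)
    (hlam : ∀ u ∈ Set.Icc 0 T, 0 ≤ lam u) (hlam_int : IntervalIntegrable lam volume 0 T)
    (ha : ∀ u ∈ Set.Icc 0 T, 0 ≤ a u ∧ a u ≤ 1 + 1 / θ)
    (hZ : IsThetaPositiveBranchingProcess P ℱ θ lam a Z) (m : ℕ) :
    IntervalIntegrable (fun v => forwardRate (lam v) (offspringProb θ (a v))
      (fun n => sizeProb P Z n v) m) volume 0 T := by
  rw [intervalIntegrable_iff]
  have h := (integrable_uncurry_forwardRate hθ0 hθ1 hlam_meas ha_meas hT hlam hlam_int ha hZ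
    m).integral_prod_left
  refine h.congr (Filter.Eventually.of_forall fun v => ?_)
  exact integral_forwardRate (P := P) (hZ.measurable v.toNNReal) (lam v) (offspringProb θ (a v)) m

/-- The Kolmogorov forward equations. -/
theorem sizeProb_eq_add_integral (hθ0 : 0 < θ) (hθ1 : θ ≤ 1) (hlam_meas : Measurable lam)
    (ha_meas : Measurable a) {T : ℝ} (hT : 0 ≤ T) (hlam : ∀ u ∈ Set.Icc 0 T, 0 ≤ lam u)
    (hlam_int : IntervalIntegrable lam volume 0 T)
    (ha : ∀ u ∈ Set.Icc 0 T, 0 ≤ a u ∧ a u ≤ 1 + 1 / θ)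
    (hZ : IsThetaPositiveBranchingProcess P ℱ θ lam a Z) (m : ℕ) :
    sizeProb P Z m T = (if m = 1 then 1 else 0) + ∫ v in (0 : ℝ)..T,
      forwardRate (lam v) (offspringProb θ (a v)) (fun n => sizeProb P Z n v) m := by
  have hfin : (Function.support fun n : ℕ => if n = m then (1 : ℝ) else 0).Finite :=
    (Set.finite_singleton m).subset fun n hn => by
      by_contra hne
      exact hn (if_neg hne)
  have hmart := hZ.martingale _ hfin
  simp only [generator_indicator] at hmart
  have hT' : ((T.toNNReal : ℝ≥0) : ℝ) = T := Real.coe_toNNReal T hT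
  -- The martingale has the same expectation at times 0 and `T`.
  have h0 := hmart.setIntegral_eq (i := 0) (j := T.toNNReal) zero_le MeasurableSet.univ
  simp only [setIntegral_univ, hT', NNReal.coe_zero, intervalIntegral.integral_same,
    sub_zero] at h0
  have hswap := intervalIntegral_integral_swap
    (integrable_uncurry_forwardRate hθ0 hθ1 hlam_meas ha_meas hT hlam hlam_int ha hZ m)
  have hi := integrable_ite_eq (P := P) (hZ.measurable T.toNNReal) m
  have hM := hmart.integrable T.toNNReal
  simp only [hT'] at hM
  -- The compensator is the difference of the bounded indicator and the integrable martingale.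
  have hint : Integrable (fun ω => ∫ u in (0 : ℝ)..T, forwardRate (lam u) (offspringProb θ (a u))
      (fun n => if Z u.toNNReal ω = n then 1 else 0) m) P := by
    refine (hi.sub hM).congr (Filter.Eventually.of_forall fun ω => ?_)
    simp
  rw [integral_sub hi hint, ← hswap] at h0
  have hinit : ∫ ω, (if Z 0 ω = m then (1 : ℝ) else 0) ∂P = if m = 1 then 1 else 0 := by
    have : (fun ω => if Z 0 ω = m then (1 : ℝ) else 0) =ᵐ[P] fun _ => if m = 1 then 1 else 0 := by
      filter_upwards [hZ.init] with ω hω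
      simp only [hω, eq_comm]
    rw [integral_congr_ae this]
    simp
  rw [hinit, integral_indicator_eq_measureReal (hZ.measurable _)] at h0
  simp only [integral_forwardRate (hZ.measurable _)] at h0
  simp only [sizeProb]
  linarith

end Forward

end ThetaBranching

/-! ### Generating functions and means of `ℕ`-valued random variables. -/

/-- The generating function of an `ℕ`-valued random variable as a power series. -/
theorem hasSum_measureReal_mul_pow {Ω : Type*} [MeasurableSpace Ω] {P : Measure Ω}
    [IsProbabilityMeasure P] {X : Ω → ℕ} (hX : Measurable X) {s : ℝ} (hs0 : 0 ≤ s)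
    (hs1 : s ≤ 1) : HasSum (fun n => P.real {ω | X ω = n} * s ^ n) (∫ ω, s ^ X ω ∂P) := by
  have := Measure.isProbabilityMeasure_map (μ := P) hX.aemeasurable
  have hint : Integrable (fun n : ℕ => s ^ n) (P.map X) := by
    refine Integrable.of_bound (C := 1) (measurable_of_countable _).aestronglyMeasurable
      (Filter.Eventually.of_forall fun n => ?_)
    rw [Real.norm_of_nonneg (pow_nonneg hs0 n)]
    exact pow_le_one₀ hs0 hs1
  have h := hasSum_integral_measure (f := fun n : ℕ => s ^ n) (μ := fun n =>
    (P.map X {n}) • Measure.dirac n) (by rwa [Measure.sum_smul_dirac])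
  rw [Measure.sum_smul_dirac,
    integral_map hX.aemeasurable (measurable_of_countable _).aestronglyMeasurable] at h
  refine h.congr_fun fun n => ?_
  rw [integral_smul_measure, integral_dirac, smul_eq_mul,
    Measure.map_apply hX (measurableSet_singleton n)]
  rfl

/-- Integral with respect to a conditional probability. -/
theorem integral_cond_eq {Ω : Type*} [MeasurableSpace Ω] (P : Measure Ω) (S : Set Ω)
    (f : Ω → ℝ) : ∫ ω, f ω ∂(P[|S]) = (P.real S)⁻¹ * ∫ ω in S, f ω ∂P := by
  rw [ProbabilityTheory.cond, integral_smul_measure, ENNReal.toReal_inv, smul_eq_mul]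
  rfl

theorem integrable_pow_of_le_one {Ω : Type*} [MeasurableSpace Ω] {P : Measure Ω}
    [IsFiniteMeasure P] {X : Ω → ℕ} (hX : Measurable X) {s : ℝ} (hs0 : 0 ≤ s)
    (hs1 : s ≤ 1) : Integrable (fun ω => s ^ X ω) P := by
  refine Integrable.of_bound (C := 1)
    ((measurable_of_countable fun n : ℕ => s ^ n).comp hX).aestronglyMeasurable
    (Filter.Eventually.of_forall fun ω => ?_)
  rw [Real.norm_of_nonneg (pow_nonneg hs0 _)]
  exact pow_le_one₀ hs0 hs1

/-- If the difference quotients at `1` of the generating function of an `ℕ`-valued random variable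
converge, then it is integrable and its mean is the limit. -/
theorem integrable_and_integral_eq_of_tendsto_pgf {Ω : Type*} [MeasurableSpace Ω] {P : Measure Ω}
    [IsProbabilityMeasure P] {X : Ω → ℕ} (hX : Measurable X) {c : ℝ}
    (h : Tendsto (fun s : ℝ => (1 - ∫ ω, s ^ X ω ∂P) / (1 - s)) (𝓝[<] 1) (𝓝 c)) :
    Integrable (fun ω => (X ω : ℝ)) P ∧ ∫ ω, (X ω : ℝ) ∂P = c := by
  have hI : Set.Ioo (0 : ℝ) 1 ∈ 𝓝[<] (1 : ℝ) := Ioo_mem_nhdsLT zero_lt_one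
  -- The difference quotient $(1-s^X)/(1-s)$ as a geometric sum: it lies between 0 and $X$ and tends
  -- to $X$ as $s\uparrow1$.
  set D : ℝ → Ω → ℝ := fun s ω => ∑ i ∈ Finset.range (X ω), s ^ i with hD
  have hDX : ∀ s, Measurable (D s) := fun s =>
    (measurable_of_countable fun n : ℕ => ∑ i ∈ Finset.range n, s ^ i).comp hX
  have hXm : Measurable fun ω => (X ω : ℝ) :=
    (measurable_of_countable fun n : ℕ => (n : ℝ)).comp hX
  have hDq : ∀ s ∈ Set.Ioo (0 : ℝ) 1, ∀ ω, D s ω = (1 - s ^ X ω) / (1 - s) := fun s hs ω => by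
    rw [eq_div_iff (by linarith [hs.2]), hD]
    exact geom_sum_mul_neg s _
  have hD0 : ∀ s ∈ Set.Ioo (0 : ℝ) 1, ∀ ω, 0 ≤ D s ω := fun s hs ω =>
    Finset.sum_nonneg fun i _ => pow_nonneg hs.1.le i
  have hDle : ∀ s ∈ Set.Ioo (0 : ℝ) 1, ∀ ω, D s ω ≤ X ω := fun s hs ω => by
    calc D s ω ≤ ∑ _i ∈ Finset.range (X ω), (1 : ℝ) :=
          Finset.sum_le_sum fun i _ => pow_le_one₀ hs.1.le hs.2.le
      _ = X ω := by simp
  have hDi : ∀ s ∈ Set.Ioo (0 : ℝ) 1, Integrable (D s) P := fun s hs => by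
    have := ((integrable_const (1 : ℝ)).sub
      (integrable_pow_of_le_one (P := P) hX hs.1.le hs.2.le)).div_const (1 - s)
    exact this.congr (Filter.Eventually.of_forall fun ω => (hDq s hs ω).symm)
  have hDint : ∀ s ∈ Set.Ioo (0 : ℝ) 1, ∫ ω, D s ω ∂P = (1 - ∫ ω, s ^ X ω ∂P) / (1 - s) := by
    intro s hs
    simp only [hDq s hs]
    rw [integral_div, integral_sub (integrable_const _)
      (integrable_pow_of_le_one hX hs.1.le hs.2.le)]
    simp
  have hlim : Tendsto (fun s => ∫ ω, D s ω ∂P) (𝓝[<] 1) (𝓝 c) :=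
    h.congr' (by filter_upwards [hI] with s hs using (hDint s hs).symm)
  have hDlim : ∀ ω, Tendsto (fun s => D s ω) (𝓝[<] 1) (𝓝 (X ω : ℝ)) := fun ω => by
    have hc : Continuous fun s : ℝ => ∑ i ∈ Finset.range (X ω), s ^ i := by fun_prop
    have := (hc.tendsto 1).mono_left (nhdsWithin_le_nhds (s := Set.Iio 1))
    simpa using this
  have hint : Integrable (fun ω => (X ω : ℝ)) P := by
    refine ⟨hXm.aestronglyMeasurable, ?_⟩
    rw [hasFiniteIntegral_iff_ofReal (Filter.Eventually.of_forall fun ω => Nat.cast_nonneg _)]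
    -- Fatou first gives integrability of $X$; only then can $X$ serve as the dominating function
    -- that identifies its mean.
    have hF := lintegral_liminf_le (μ := P) (u := 𝓝[<] (1 : ℝ))
      (f := fun s ω => ENNReal.ofReal (D s ω)) fun s => (hDX s).ennreal_ofReal
    have e1 : ∀ ω, liminf (fun s => ENNReal.ofReal (D s ω)) (𝓝[<] (1 : ℝ)) =
        ENNReal.ofReal (X ω) := fun ω =>
      ((ENNReal.continuous_ofReal.tendsto _).comp (hDlim ω)).liminf_eq
    have e2 : liminf (fun s => ∫⁻ ω, ENNReal.ofReal (D s ω) ∂P) (𝓝[<] (1 : ℝ)) =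
        ENNReal.ofReal c := by
      refine Tendsto.liminf_eq (((ENNReal.continuous_ofReal.tendsto _).comp hlim).congr' ?_)
      filter_upwards [hI] with s hs
      exact ofReal_integral_eq_lintegral_ofReal (hDi s hs)
        (Filter.Eventually.of_forall (hD0 s hs))
    simp only [e1, e2] at hF
    exact hF.trans_lt ENNReal.ofReal_lt_top
  refine ⟨hint, tendsto_nhds_unique ?_ hlim⟩
  refine tendsto_integral_filter_of_dominated_convergence (fun ω => (X ω : ℝ))
    (Filter.Eventually.of_forall fun s => (hDX s).aestronglyMeasurable) ?_ hint
    (Filter.Eventually.of_forall hDlim)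
  filter_upwards [hI] with s hs
  refine Filter.Eventually.of_forall fun ω => ?_
  rw [Real.norm_of_nonneg (hD0 s hs ω)]
  exact hDle s hs ω

/-! ### The explicit generating function and its normalisation by the mean. -/

namespace ThetaBranching

/-- `1 - envPGFCompl` is the generating function of the population size in terms of the
environment. -/
noncomputable def envPGFCompl (θ : ℝ) (lam a : ℝ → ℝ) (t s : ℝ) : ℝ :=
  (envMean lam a t ^ (-θ) * ((1 - s) ^ (-θ) - (1 + θ)⁻¹) + envV θ lam a t + (1 + θ)⁻¹) ^ (-1 / θ)

/-- The normalised base `(1 - s)^{-θ} - 1 / (1 + θ) + μ_t^θ (V_t + 1 / (1 + θ))` of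
`envPGFCompl`. -/
noncomputable def envBase (θ : ℝ) (lam a : ℝ → ℝ) (t s : ℝ) : ℝ :=
  (1 - s) ^ (-θ) - (1 + θ)⁻¹ + envMean lam a t ^ θ * envV θ lam a t +
    envMean lam a t ^ θ * (1 + θ)⁻¹

section EnvPGF

variable {θ s t : ℝ} {lam a : ℝ → ℝ}

theorem inv_one_add_lt_one (hθ0 : 0 < θ) : (1 + θ)⁻¹ < 1 :=
  inv_lt_one_of_one_lt₀ (by linarith)

theorem one_le_one_sub_rpow_neg (hθ0 : 0 < θ) (hs0 : 0 ≤ s) (hs1 : s < 1) :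
    1 ≤ (1 - s) ^ (-θ) :=
  Real.one_le_rpow_of_pos_of_le_one_of_nonpos (by linarith) (by linarith) (by linarith)

theorem envBase_pos (hθ0 : 0 < θ) (hV : 0 ≤ envV θ lam a t) (hs0 : 0 ≤ s) (hs1 : s < 1) :
    0 < envBase θ lam a t s := by
  have h1 := inv_one_add_lt_one hθ0
  have h2 := one_le_one_sub_rpow_neg hθ0 hs0 hs1
  have h3 : 0 < envMean lam a t ^ θ := Real.rpow_pos_of_pos (envMean_pos _ _ _) _
  have h4 : 0 < (1 + θ)⁻¹ := by positivity
  rw [envBase]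
  have := mul_nonneg h3.le hV
  have := mul_pos h3 h4
  linarith

/-- Factors $\mu^{-\theta}$ out of the base; its power $-1/\theta$ is $\mu$. -/
theorem envPGFCompl_eq (hθ0 : 0 < θ) (hV : 0 ≤ envV θ lam a t) (hs0 : 0 ≤ s) (hs1 : s < 1) :
    envPGFCompl θ lam a t s = envMean lam a t * envBase θ lam a t s ^ (-1 / θ) := by
  have hm := envMean_pos lam a t
  have hb := envBase_pos hθ0 hV hs0 hs1
  have h1 : envMean lam a t ^ (-θ) * ((1 - s) ^ (-θ) - (1 + θ)⁻¹) + envV θ lam a t +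
      (1 + θ)⁻¹ = envMean lam a t ^ (-θ) * envBase θ lam a t s := by
    rw [envBase]
    linear_combination (-(envV θ lam a t + (1 + θ)⁻¹)) * envMean_rpow_mul_rpow_neg θ lam a t
  rw [envPGFCompl, h1, Real.mul_rpow (Real.rpow_nonneg hm.le _) hb.le, ← Real.rpow_mul hm.le]
  have : -θ * (-1 / θ) = 1 := by field_simp
  rw [this, Real.rpow_one]

/-- The term $(1-s)^{-\theta}$ dominates the base as $s\uparrow1$; once it is factored out, the base
tends to 1. This identifies `envMean` with the mean. -/
theorem tendsto_envPGFCompl_div (hθ0 : 0 < θ) (hV : 0 ≤ envV θ lam a t) :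
    Tendsto (fun s => envPGFCompl θ lam a t s / (1 - s)) (𝓝[<] 1) (𝓝 (envMean lam a t)) := by
  have hs : Tendsto (fun s : ℝ => (1 - s) ^ θ) (𝓝[<] 1) (𝓝 0) := by
    have hc : ContinuousAt (fun s : ℝ => (1 - s) ^ θ) 1 :=
      (continuousAt_const.sub continuousAt_id).rpow_const (Or.inr hθ0.le)
    have := hc.tendsto.mono_left (nhdsWithin_le_nhds (s := Set.Iio 1))
    simpa [Real.zero_rpow hθ0.ne'] using this
  have hbase : Tendsto (fun s : ℝ => 1 + (1 - s) ^ θ * (envMean lam a t ^ θ * envV θ lam a t +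
      envMean lam a t ^ θ * (1 + θ)⁻¹ - (1 + θ)⁻¹)) (𝓝[<] 1) (𝓝 1) := by
    simpa using (hs.mul_const _).const_add 1
  have hlim := (hbase.rpow_const (p := -1 / θ) (Or.inl one_ne_zero)).const_mul (envMean lam a t)
  rw [Real.one_rpow, mul_one] at hlim
  refine hlim.congr' ?_
  filter_upwards [Ioo_mem_nhdsLT (zero_lt_one (α := ℝ))] with s hs
  have h1s : 0 < 1 - s := by linarith [hs.2]
  have hb := envBase_pos hθ0 hV hs.1.le hs.2
  have e1 : 1 + (1 - s) ^ θ * (envMean lam a t ^ θ * envV θ lam a t +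
      envMean lam a t ^ θ * (1 + θ)⁻¹ - (1 + θ)⁻¹) = envBase θ lam a t s * (1 - s) ^ θ := by
    have : (1 - s) ^ θ * (1 - s) ^ (-θ) = 1 := by
      rw [← Real.rpow_add h1s, add_neg_cancel, Real.rpow_zero]
    rw [envBase]
    linear_combination -this
  have e2 : θ * (-1 / θ) = -1 := by field_simp
  rw [e1, Real.mul_rpow hb.le (Real.rpow_nonneg h1s.le _), ← Real.rpow_mul h1s.le, e2,
    Real.rpow_neg_one, envPGFCompl_eq hθ0 hV hs.1.le hs.2]
  ring

end EnvPGF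

/-- The standing assumptions on the environment. -/
structure IsEnvironment (θ : ℝ) (lam a : ℝ → ℝ) : Prop where
  pos : 0 < θ
  le_one : θ ≤ 1
  measurable_lam : Measurable lam
  lam_nonneg : ∀ t, 0 ≤ t → 0 ≤ lam t
  lam_int : ∀ t, 0 ≤ t → IntervalIntegrable lam volume 0 t
  measurable_a : Measurable a
  a_mem : ∀ t, 0 ≤ t → 0 ≤ a t ∧ a t ≤ 1 + 1 / θ

namespace IsEnvironment

variable {θ : ℝ} {lam a : ℝ → ℝ} {t : ℝ}

theorem intervalIntegrable_mul_sub_one (hE : IsEnvironment θ lam a) (ht : 0 ≤ t) :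
    IntervalIntegrable (fun u => lam u * (a u - 1)) volume 0 t :=
  ThetaBranching.intervalIntegrable_mul_sub_one ht (hE.lam_int t ht) hE.measurable_a
    fun u hu => hE.a_mem u hu.1

theorem envV_nonneg (hE : IsEnvironment θ lam a) (ht : 0 ≤ t) : 0 ≤ envV θ lam a t :=
  ThetaBranching.envV_nonneg hE.pos ht fun u hu => hE.lam_nonneg u hu.1

/-- Since $a\ge0$, $V_t-\frac1{1+\theta}\mu_t^{-\theta}$ is nondecreasing: its derivative is
$\frac{\theta}{1+\theta}\lambda a\mu^{-\theta}$. -/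
theorem envMean_rpow_neg_le (hE : IsEnvironment θ lam a) (ht : 0 ≤ t) :
    envMean lam a t ^ (-θ) ≤ 1 + (1 + θ) * envV θ lam a t := by
  have hθ := hE.pos
  have h := envV_add_mul_le (θ := θ) (lam := lam) (a := a) (c := -(1 + θ)⁻¹)
    (Set.left_mem_Icc.2 ht) (fun u hu => hE.lam_nonneg u hu.1) (hE.lam_int t ht)
    (hE.intervalIntegrable_mul_sub_one ht) (by
      intro v hv
      have : θ * (1 + θ)⁻¹ - -(1 + θ)⁻¹ * θ * (a v - 1) = θ * (1 + θ)⁻¹ * a v := by ring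
      rw [this]
      exact mul_nonneg (by positivity) (hE.a_mem v hv.1).1)
  simp only [envV_zero, envMean_zero, Real.one_rpow] at h
  have h2 := mul_le_mul_of_nonneg_left h (by linarith : (0 : ℝ) ≤ 1 + θ)
  have h3 : (1 + θ) * (1 + θ)⁻¹ = 1 := mul_inv_cancel₀ (by linarith)
  have h4 : (1 + θ) * (envV θ lam a t + -(1 + θ)⁻¹ * envMean lam a t ^ (-θ)) =
      (1 + θ) * envV θ lam a t - envMean lam a t ^ (-θ) := by
    linear_combination (-(envMean lam a t ^ (-θ))) * h3
  rw [h4] at h2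
  nlinarith

/-- The analytic form of $m_t\ge1$, obtained from the preceding bound multiplied by
$\mu_t^\theta/(1+\theta)$. -/
theorem one_le_envBase_zero (hE : IsEnvironment θ lam a) (ht : 0 ≤ t) :
    1 ≤ envBase θ lam a t 0 := by
  have hθ := hE.pos
  have h := hE.envMean_rpow_neg_le ht
  have hm : 0 < envMean lam a t ^ θ := Real.rpow_pos_of_pos (envMean_pos _ _ _) _
  have h2 := mul_le_mul_of_nonneg_left h hm.le
  rw [envMean_rpow_mul_rpow_neg] at h2
  have hi : 0 < (1 + θ)⁻¹ := by positivity
  have h3 := mul_le_mul_of_nonneg_left h2 hi.le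
  have h4 : (1 + θ)⁻¹ * (envMean lam a t ^ θ * (1 + (1 + θ) * envV θ lam a t)) =
      envMean lam a t ^ θ * envV θ lam a t + envMean lam a t ^ θ * (1 + θ)⁻¹ := by
    field_simp
    ring
  simp only [envBase, sub_zero, Real.one_rpow]
  linarith

end IsEnvironment

theorem compl_setOf_size_pos {Ω : Type*} (Z : ℝ≥0 → Ω → ℕ) (t : ℝ≥0) :
    {ω | 0 < Z t ω}ᶜ = {ω | Z t ω = 0} := by
  ext ω
  simp

theorem measurableSet_size_pos {Ω : Type*} [mΩ : MeasurableSpace Ω] {P : Measure Ω}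
    {ℱ : Filtration ℝ≥0 mΩ} {θ : ℝ} {lam a : ℝ → ℝ} {Z : ℝ≥0 → Ω → ℕ}
    (hZ : IsThetaPositiveBranchingProcess P ℱ θ lam a Z) (t : ℝ≥0) :
    MeasurableSet {ω | 0 < Z t ω} :=
  measurableSet_lt measurable_const (hZ.measurable t)

/-! ### The law of $Z_t$ in terms of the environment. -/

section Law

variable {Ω : Type*} [mΩ : MeasurableSpace Ω] {P : Measure Ω} [IsProbabilityMeasure P]
  {ℱ : Filtration ℝ≥0 mΩ} {θ : ℝ} {lam a : ℝ → ℝ} {Z : ℝ≥0 → Ω → ℕ}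

/-- The generating function of the population size. -/
theorem integral_pow_eq (hE : IsEnvironment θ lam a)
    (hZ : IsThetaPositiveBranchingProcess P ℱ θ lam a Z) (t : ℝ≥0) {s : ℝ} (hs0 : 0 ≤ s)
    (hs1 : s < 1) : ∫ ω, s ^ Z t ω ∂P = 1 - envPGFCompl θ lam a t s := by
  have ht : (0 : ℝ) ≤ t := t.coe_nonneg
  have h1 := hasSum_measureReal_mul_pow (P := P) (hZ.measurable t) hs0 hs1.le
  have h2 := hasSum_pgf_of_forward (p := sizeProb P Z) hE.pos hE.le_one ht
    (fun u hu => hE.lam_nonneg u hu.1) (hE.lam_int t ht) hE.measurable_a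
    (fun u hu => hE.a_mem u hu.1) (sizeProb_nonneg P Z) (sizeProb_le_one Z)
    (fun m => intervalIntegrable_forwardRate_sizeProb hE.pos hE.le_one hE.measurable_lam
      hE.measurable_a ht (fun u hu => hE.lam_nonneg u hu.1) (hE.lam_int t ht)
      (fun u hu => hE.a_mem u hu.1) hZ m)
    (fun m u hu => sizeProb_eq_add_integral hE.pos hE.le_one hE.measurable_lam
      hE.measurable_a hu.1 (fun v hv => hE.lam_nonneg v hv.1) (hE.lam_int u hu.1)
      (fun v hv => hE.a_mem v hv.1) hZ m) hs0 hs1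
  simp only [sizeProb, Real.toNNReal_coe] at h2
  exact h1.unique h2

theorem integrable_size_and_meanSize_eq (hE : IsEnvironment θ lam a)
    (hZ : IsThetaPositiveBranchingProcess P ℱ θ lam a Z) (t : ℝ≥0) :
    Integrable (fun ω => (Z t ω : ℝ)) P ∧ meanSize P Z t = envMean lam a t := by
  refine integrable_and_integral_eq_of_tendsto_pgf (hZ.measurable t) ?_
  refine (tendsto_envPGFCompl_div hE.pos (hE.envV_nonneg t.coe_nonneg)).congr' ?_
  filter_upwards [Ioo_mem_nhdsLT (zero_lt_one (α := ℝ))] with s hs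
  rw [integral_pow_eq hE hZ t hs.1.le hs.2, sub_sub_cancel]

theorem measureReal_eq_zero_eq (hE : IsEnvironment θ lam a)
    (hZ : IsThetaPositiveBranchingProcess P ℱ θ lam a Z) (t : ℝ≥0) :
    P.real {ω | Z t ω = 0} = 1 - envPGFCompl θ lam a t 0 := by
  -- As $0^0=1$, the generating function at 0 is the extinction probability.
  rw [← integral_pow_eq hE hZ t le_rfl zero_lt_one,
    ← integral_indicator_eq_measureReal (hZ.measurable t)]
  simp only [zero_pow_eq]

theorem survivalProb_eq (hE : IsEnvironment θ lam a)
    (hZ : IsThetaPositiveBranchingProcess P ℱ θ lam a Z) (t : ℝ≥0) :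
    survivalProb P Z t = envPGFCompl θ lam a t 0 := by
  have h := probReal_compl_eq_one_sub (μ := P) (measurableSet_size_pos hZ t)
  rw [compl_setOf_size_pos, measureReal_eq_zero_eq hE hZ] at h
  rw [survivalProb]
  linarith

theorem condMeanSize_eq (hE : IsEnvironment θ lam a)
    (hZ : IsThetaPositiveBranchingProcess P ℱ θ lam a Z) (t : ℝ≥0) :
    condMeanSize P Z t = envMean lam a t / envPGFCompl θ lam a t 0 := by
  rw [condMeanSize, integral_cond_eq, setIntegral_eq_integral_of_forall_compl_eq_zero
    (fun ω hω => by simpa using hω)]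
  change (survivalProb P Z t)⁻¹ * meanSize P Z t = _
  rw [survivalProb_eq hE hZ, (integrable_size_and_meanSize_eq hE hZ t).2]
  ring

theorem condPGF_eq (hE : IsEnvironment θ lam a)
    (hZ : IsThetaPositiveBranchingProcess P ℱ θ lam a Z) (t : ℝ≥0) {s : ℝ} (hs0 : 0 ≤ s)
    (hs1 : s < 1) :
    condPGF P Z t s =
      (envPGFCompl θ lam a t 0 - envPGFCompl θ lam a t s) / envPGFCompl θ lam a t 0 := by
  have hS := measurableSet_size_pos hZ t
  have hsplit := integral_add_compl hS
    (integrable_pow_of_le_one (P := P) (hZ.measurable t) hs0 hs1.le)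
  have h0 : ∫ ω in {ω | 0 < Z t ω}ᶜ, s ^ Z t ω ∂P = 1 - envPGFCompl θ lam a t 0 := by
    rw [setIntegral_congr_fun (g := fun _ => (1 : ℝ)) hS.compl, compl_setOf_size_pos,
      setIntegral_const, measureReal_eq_zero_eq hE hZ, smul_eq_mul, mul_one]
    intro ω hω
    rw [compl_setOf_size_pos] at hω
    simp [show Z t ω = 0 from hω]
  rw [h0, integral_pow_eq hE hZ t hs0 hs1] at hsplit
  rw [condPGF, integral_cond_eq]
  change (survivalProb P Z t)⁻¹ * _ = _
  rw [survivalProb_eq hE hZ, eq_sub_of_add_eq hsplit]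
  ring

theorem vIntegrand_eq (hE : IsEnvironment θ lam a)
    (hZ : IsThetaPositiveBranchingProcess P ℱ θ lam a Z) {u : ℝ} (hu : 0 ≤ u) :
    vIntegrand P θ lam Z u = envMean lam a u ^ (-θ) * lam u := by
  rw [vIntegrand, (integrable_size_and_meanSize_eq hE hZ _).2, Real.coe_toNNReal u hu]

theorem intervalIntegrable_vIntegrand (hE : IsEnvironment θ lam a)
    (hZ : IsThetaPositiveBranchingProcess P ℱ θ lam a Z) (t : ℝ≥0) :
    IntervalIntegrable (vIntegrand P θ lam Z) volume 0 t := by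
  refine (intervalIntegrable_envMean_rpow_mul (hE.lam_int t t.coe_nonneg)
    (hE.intervalIntegrable_mul_sub_one t.coe_nonneg) (-θ)).congr fun u hu => ?_
  rw [Set.uIoc_of_le t.coe_nonneg] at hu
  exact (vIntegrand_eq hE hZ hu.1.le).symm

theorem V_eq (hE : IsEnvironment θ lam a)
    (hZ : IsThetaPositiveBranchingProcess P ℱ θ lam a Z) (t : ℝ≥0) :
    V P θ lam Z t = envV θ lam a t := by
  rw [V, envV]
  congr 1
  refine intervalIntegral.integral_congr fun u hu => ?_
  rw [Set.uIcc_of_le t.coe_nonneg] at hu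
  exact vIntegrand_eq hE hZ hu.1

end Law

end ThetaBranching

/-! ### Asymptotics and the criterion. -/

namespace ThetaBranching

section Asymptotics

variable {Ω : Type*} [mΩ : MeasurableSpace Ω] {P : Measure Ω} [IsProbabilityMeasure P]
  {ℱ : Filtration ℝ≥0 mΩ} {θ : ℝ} {lam a : ℝ → ℝ} {Z : ℝ≥0 → Ω → ℕ}

/-- The mean cancels in $\mu_t/P(Z_t>0)$. Both directions of the criterion rest on this identity. -/
theorem condMeanSize_eq_envBase_rpow (hE : IsEnvironment θ lam a)
    (hZ : IsThetaPositiveBranchingProcess P ℱ θ lam a Z) (t : ℝ≥0) :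
    condMeanSize P Z t = envBase θ lam a t 0 ^ (1 / θ) := by
  have hV := hE.envV_nonneg t.coe_nonneg
  have hb := envBase_pos hE.pos hV le_rfl zero_lt_one
  rw [condMeanSize_eq hE hZ, envPGFCompl_eq hE.pos hV le_rfl zero_lt_one, neg_div,
    Real.rpow_neg hb.le]
  field_simp [(envMean_pos lam a t).ne']

theorem one_le_condMeanSize (hE : IsEnvironment θ lam a)
    (hZ : IsThetaPositiveBranchingProcess P ℱ θ lam a Z) (t : ℝ≥0) :
    1 ≤ condMeanSize P Z t := by
  have hθ := hE.pos
  rw [condMeanSize_eq_envBase_rpow hE hZ]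
  exact Real.one_le_rpow (hE.one_le_envBase_zero t.coe_nonneg) (by positivity)

theorem survivalProb_eq_div (hE : IsEnvironment θ lam a)
    (hZ : IsThetaPositiveBranchingProcess P ℱ θ lam a Z) (t : ℝ≥0) :
    survivalProb P Z t = meanSize P Z t / condMeanSize P Z t := by
  rw [condMeanSize_eq hE hZ, (integrable_size_and_meanSize_eq hE hZ t).2, survivalProb_eq hE hZ,
    div_div_cancel₀ (envMean_pos lam a t).ne']

theorem survivalProb_pos (hE : IsEnvironment θ lam a)
    (hZ : IsThetaPositiveBranchingProcess P ℱ θ lam a Z) (t : ℝ≥0) : 0 < survivalProb P Z t := by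
  rw [survivalProb_eq_div hE hZ, (integrable_size_and_meanSize_eq hE hZ t).2]
  exact div_pos (envMean_pos lam a t) (zero_lt_one.trans_le (one_le_condMeanSize hE hZ t))

theorem condPGF_eq_envBase_rpow (hE : IsEnvironment θ lam a)
    (hZ : IsThetaPositiveBranchingProcess P ℱ θ lam a Z) (t : ℝ≥0) {s : ℝ} (hs0 : 0 ≤ s)
    (hs1 : s < 1) :
    condPGF P Z t s = 1 - condMeanSize P Z t * envBase θ lam a t s ^ (-1 / θ) := by
  have hpos := survivalProb_pos hE hZ t
  rw [survivalProb_eq hE hZ] at hpos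
  rw [condPGF_eq hE hZ t hs0 hs1, condMeanSize_eq hE hZ, sub_div, div_self hpos.ne',
    envPGFCompl_eq (s := s) hE.pos (hE.envV_nonneg t.coe_nonneg) hs0 hs1]
  ring

theorem measureReal_eq_zero_eq_one_sub_survivalProb (hE : IsEnvironment θ lam a)
    (hZ : IsThetaPositiveBranchingProcess P ℱ θ lam a Z) (t : ℝ≥0) :
    P.real {ω | Z t ω = 0} = 1 - survivalProb P Z t := by
  rw [measureReal_eq_zero_eq hE hZ, survivalProb_eq hE hZ]

theorem meanSize_pos (hE : IsEnvironment θ lam a)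
    (hZ : IsThetaPositiveBranchingProcess P ℱ θ lam a Z) (t : ℝ≥0) : 0 < meanSize P Z t := by
  rw [(integrable_size_and_meanSize_eq hE hZ t).2]
  exact envMean_pos lam a t

theorem envBase_eq (hE : IsEnvironment θ lam a)
    (hZ : IsThetaPositiveBranchingProcess P ℱ θ lam a Z) (t : ℝ≥0) (s : ℝ) :
    envBase θ lam a t s = (1 - s) ^ (-θ) - (1 + θ)⁻¹ + meanSize P Z t ^ θ * V P θ lam Z t +
      meanSize P Z t ^ θ * (1 + θ)⁻¹ := by
  rw [V_eq hE hZ, (integrable_size_and_meanSize_eq hE hZ t).2, envBase]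

theorem meanSize_rpow_mul_V_nonneg (hE : IsEnvironment θ lam a)
    (hZ : IsThetaPositiveBranchingProcess P ℱ θ lam a Z) (t : ℝ≥0) :
    0 ≤ meanSize P Z t ^ θ * V P θ lam Z t := by
  rw [V_eq hE hZ]
  exact mul_nonneg (Real.rpow_nonneg (meanSize_pos hE hZ t).le _) (hE.envV_nonneg t.coe_nonneg)

theorem one_sub_inv_one_add (hθ0 : 0 < θ) : 1 - (1 + θ)⁻¹ = θ * (1 + θ)⁻¹ := by
  field_simp
  ring

theorem tendsto_envBase (hE : IsEnvironment θ lam a)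
    (hZ : IsThetaPositiveBranchingProcess P ℱ θ lam a Z)
    (hmean : Tendsto (meanSize P Z) atTop (𝓝 0)) {M : ℝ}
    (hM : Tendsto (fun t => meanSize P Z t ^ θ * V P θ lam Z t) atTop (𝓝 M)) (s : ℝ) :
    Tendsto (fun t : ℝ≥0 => envBase θ lam a t s) atTop
      (𝓝 (M - (1 + θ)⁻¹ + (1 - s) ^ (-θ))) := by
  have h0 : Tendsto (fun t => meanSize P Z t ^ θ) atTop (𝓝 0) := by
    have := hmean.rpow_const (p := θ) (Or.inr hE.pos.le)
    rwa [Real.zero_rpow hE.pos.ne'] at this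
  have h := (hM.const_add ((1 - s) ^ (-θ) - (1 + θ)⁻¹)).add (h0.mul_const (1 + θ)⁻¹)
  have e : (1 - s) ^ (-θ) - (1 + θ)⁻¹ + M + 0 * (1 + θ)⁻¹ =
      M - (1 + θ)⁻¹ + (1 - s) ^ (-θ) := by ring
  rw [e] at h
  exact h.congr fun t => (envBase_eq hE hZ t s).symm

theorem tendsto_condMeanSize (hE : IsEnvironment θ lam a)
    (hZ : IsThetaPositiveBranchingProcess P ℱ θ lam a Z)
    (hmean : Tendsto (meanSize P Z) atTop (𝓝 0)) {M : ℝ}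
    (hM : Tendsto (fun t => meanSize P Z t ^ θ * V P θ lam Z t) atTop (𝓝 M)) :
    Tendsto (condMeanSize P Z) atTop (𝓝 ((M + θ * (1 + θ)⁻¹) ^ (1 / θ))) := by
  have hθ := hE.pos
  have h := (tendsto_envBase hE hZ hmean hM 0).rpow_const (p := 1 / θ) (Or.inr (by positivity))
  have e : M - (1 + θ)⁻¹ + (1 - 0) ^ (-θ) = M + θ * (1 + θ)⁻¹ := by
    rw [sub_zero, Real.one_rpow, ← one_sub_inv_one_add hθ]
    ring
  rw [e] at h
  exact h.congr fun t => (condMeanSize_eq_envBase_rpow hE hZ t).symm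

theorem tendsto_condPGF (hE : IsEnvironment θ lam a)
    (hZ : IsThetaPositiveBranchingProcess P ℱ θ lam a Z)
    (hmean : Tendsto (meanSize P Z) atTop (𝓝 0)) {M : ℝ} (hM0 : 0 ≤ M)
    (hM : Tendsto (fun t => meanSize P Z t ^ θ * V P θ lam Z t) atTop (𝓝 M)) {s : ℝ}
    (hs0 : 0 ≤ s) (hs1 : s < 1) :
    Tendsto (fun t => condPGF P Z t s) atTop (𝓝 (1 - (M + θ * (1 + θ)⁻¹) ^ (1 / θ) *
      (M - (1 + θ)⁻¹ + (1 - s) ^ (-θ)) ^ (-1 / θ))) := by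
  have h1 := inv_one_add_lt_one hE.pos
  have h2 := one_le_one_sub_rpow_neg hE.pos hs0 hs1
  -- The negative power passes to the limit because the limiting base is positive: $M\ge0$ and
  -- $(1-s)^{-\theta}\ge1>\frac1{1+\theta}$.
  have h := ((tendsto_condMeanSize hE hZ hmean hM).mul
    ((tendsto_envBase hE hZ hmean hM s).rpow_const (p := -1 / θ)
      (Or.inl (by linarith : (0 : ℝ) < _).ne'))).const_sub 1
  exact h.congr fun t => (condPGF_eq_envBase_rpow hE hZ t hs0 hs1).symm

/-- $\mu_t=m_tP(Z_t>0)$ is a convergent factor times a null one. -/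
theorem StrictlySubcritical.tendsto_meanSize (hE : IsEnvironment θ lam a)
    (hZ : IsThetaPositiveBranchingProcess P ℱ θ lam a Z) (h : StrictlySubcritical P Z) :
    Tendsto (meanSize P Z) atTop (𝓝 0) := by
  obtain ⟨hq, m, -, hm⟩ := h
  have hsurv : Tendsto (survivalProb P Z) atTop (𝓝 0) := by
    have := hq.const_sub 1
    rw [sub_self] at this
    refine this.congr fun t => ?_
    rw [measureReal_eq_zero_eq_one_sub_survivalProb hE hZ, sub_sub_cancel]
  have := hm.mul hsurv
  rw [mul_zero] at this
  refine this.congr fun t => ?_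
  rw [survivalProb_eq_div hE hZ,
    mul_div_cancel₀ _ (zero_lt_one.trans_le (one_le_condMeanSize hE hZ t)).ne']

/-- By `envMean_rpow_neg_le`, $V_{t,\theta}\ge(\mu_t^{-\theta}-1)/(1+\theta)$, which diverges as
$\mu_t\to0$. -/
theorem StrictlySubcritical.tendsto_V (hE : IsEnvironment θ lam a)
    (hZ : IsThetaPositiveBranchingProcess P ℱ θ lam a Z) (h : StrictlySubcritical P Z) :
    Tendsto (V P θ lam Z) atTop atTop := by
  have hθ := hE.pos
  have hmean := h.tendsto_meanSize hE hZ
  have h1 : Tendsto (fun t => meanSize P Z t ^ (-θ)) atTop atTop :=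
    (tendsto_rpow_neg_nhdsGT_zero (by linarith)).comp (tendsto_nhdsWithin_iff.2
      ⟨hmean, Filter.Eventually.of_forall fun t => meanSize_pos hE hZ t⟩)
  have h2 : Tendsto (fun t => (1 + θ)⁻¹ * (meanSize P Z t ^ (-θ) - 1)) atTop atTop :=
    (tendsto_atTop_add_const_right _ (-1) h1).const_mul_atTop (by positivity)
  refine tendsto_atTop_mono (fun t => ?_) h2
  rw [inv_mul_le_iff₀ (by positivity), V_eq hE hZ, (integrable_size_and_meanSize_eq hE hZ t).2]
  linarith [hE.envMean_rpow_neg_le t.coe_nonneg]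

/-- Solve $m_t^\theta=B_t(0)$ for $\mu_t^\theta V_{t,\theta}$; all other terms converge. -/
theorem StrictlySubcritical.exists_tendsto (hE : IsEnvironment θ lam a)
    (hZ : IsThetaPositiveBranchingProcess P ℱ θ lam a Z) (h : StrictlySubcritical P Z) :
    ∃ M : ℝ, 0 ≤ M ∧ Tendsto (fun t => meanSize P Z t ^ θ * V P θ lam Z t) atTop (𝓝 M) := by
  have hθ := hE.pos
  have hmean := h.tendsto_meanSize hE hZ
  obtain ⟨-, m, -, hm⟩ := h
  have h0 : Tendsto (fun t => meanSize P Z t ^ θ) atTop (𝓝 0) := by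
    have := hmean.rpow_const (p := θ) (Or.inr hθ.le)
    rwa [Real.zero_rpow hθ.ne'] at this
  have hlim := ((hm.rpow_const (p := θ) (Or.inr hθ.le)).sub_const (1 - (1 + θ)⁻¹)).sub
    (h0.mul_const (1 + θ)⁻¹)
  have hM := hlim.congr (f₂ := fun t => meanSize P Z t ^ θ * V P θ lam Z t) fun t => by
    have hb := envBase_pos (s := 0) hθ (hE.envV_nonneg (t := t) t.coe_nonneg) le_rfl zero_lt_one
    rw [condMeanSize_eq_envBase_rpow hE hZ, ← Real.rpow_mul hb.le, one_div,
      inv_mul_cancel₀ hθ.ne', Real.rpow_one, envBase_eq hE hZ, sub_zero, Real.one_rpow]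
    ring
  exact ⟨_, ge_of_tendsto' hM fun t => meanSize_rpow_mul_V_nonneg hE hZ t, hM⟩

/-- Divergence of $V$ serves only to force $\mu_t\to0$, by dividing $\mu_t^\theta V_{t,\theta}$ by
$V_{t,\theta}$. Extinction then follows from $P(Z_t=0)=1-\mu_t/m_t$. -/
theorem strictlySubcritical_of_tendsto (hE : IsEnvironment θ lam a)
    (hZ : IsThetaPositiveBranchingProcess P ℱ θ lam a Z)
    (hV : Tendsto (V P θ lam Z) atTop atTop) {M : ℝ} (hM0 : 0 ≤ M)
    (hM : Tendsto (fun t => meanSize P Z t ^ θ * V P θ lam Z t) atTop (𝓝 M)) :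
    StrictlySubcritical P Z := by
  have hθ := hE.pos
  have hmean : Tendsto (meanSize P Z) atTop (𝓝 0) := by
    have h1 : Tendsto (fun t => meanSize P Z t ^ θ) atTop (𝓝 0) := by
      refine (hM.div_atTop hV).congr' ?_
      filter_upwards [hV.eventually_gt_atTop 0] with t ht
      exact mul_div_cancel_right₀ _ ht.ne'
    have h2 := h1.rpow_const (p := 1 / θ) (Or.inr (by positivity))
    rw [Real.zero_rpow (by positivity)] at h2
    refine h2.congr fun t => ?_
    rw [← Real.rpow_mul (meanSize_pos hE hZ t).le, mul_one_div_cancel hθ.ne', Real.rpow_one]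
  have hm := tendsto_condMeanSize hE hZ hmean hM
  have hmpos : 0 < (M + θ * (1 + θ)⁻¹) ^ (1 / θ) := by positivity
  refine ⟨?_, _, ge_of_tendsto' hm fun t => one_le_condMeanSize hE hZ t, hm⟩
  have hs := (hmean.div hm hmpos.ne').const_sub 1
  rw [zero_div, sub_zero] at hs
  refine hs.congr fun t => ?_
  rw [measureReal_eq_zero_eq_one_sub_survivalProb hE hZ, survivalProb_eq_div hE hZ]
  rfl

theorem isEquivalent_survivalProb (hE : IsEnvironment θ lam a)
    (hZ : IsThetaPositiveBranchingProcess P ℱ θ lam a Z) {m : ℝ} (hm0 : m ≠ 0)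
    (hm : Tendsto (condMeanSize P Z) atTop (𝓝 m)) :
    survivalProb P Z ~[atTop] (fun t => m⁻¹ * meanSize P Z t) := by
  have hpos : ∀ t, condMeanSize P Z t ≠ 0 := fun t =>
    (zero_lt_one.trans_le (one_le_condMeanSize hE hZ t)).ne'
  refine (isEquivalent_of_tendsto_one ?_)
  have h := tendsto_const_nhds (x := m).div hm hm0
  rw [div_self hm0] at h
  refine h.congr fun t => ?_
  have h1 := (meanSize_pos hE hZ t).ne'
  have h2 := hpos t
  simp only [Pi.div_apply]
  rw [survivalProb_eq_div hE hZ]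
  field_simp

end Asymptotics

end ThetaBranching

open ThetaBranching in
theorem theorem5 {Ω : Type*} [mΩ : MeasurableSpace Ω] (P : Measure Ω) [IsProbabilityMeasure P]
    (ℱ : Filtration ℝ≥0 mΩ)
    (θ : ℝ) (hθ0 : 0 < θ) (hθ1 : θ ≤ 1)
    (lam a : ℝ → ℝ)
    (hlam_meas : Measurable lam) (hlam_nonneg : ∀ t, 0 ≤ t → 0 ≤ lam t)
    (hlam_int : ∀ t, 0 ≤ t → IntervalIntegrable lam volume 0 t)
    (ha_meas : Measurable a) (ha : ∀ t, 0 ≤ t → 0 ≤ a t ∧ a t ≤ 1 + 1 / θ)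
    (Z : ℝ≥0 → Ω → ℕ) (hZ : IsThetaPositiveBranchingProcess P ℱ θ lam a Z) :
    -- the quantities in the claim are well defined
    ((∀ t, Integrable (fun ω => (Z t ω : ℝ)) P ∧ 0 < survivalProb P Z t ∧
        IntervalIntegrable (vIntegrand P θ lam Z) volume 0 t)) ∧
    -- the criterion
    (StrictlySubcritical P Z ↔
      Tendsto (V P θ lam Z) atTop atTop ∧
        ∃ M : ℝ, 0 ≤ M ∧ Tendsto (fun t => meanSize P Z t ^ θ * V P θ lam Z t) atTop (𝓝 M)) ∧
    -- the limits in the strictly subcritical case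
    (StrictlySubcritical P Z → ∀ M : ℝ,
      Tendsto (fun t => meanSize P Z t ^ θ * V P θ lam Z t) atTop (𝓝 M) →
        ∀ m : ℝ, m = (M + θ * (1 + θ)⁻¹) ^ (1 / θ) →
          Tendsto (meanSize P Z) atTop (𝓝 0) ∧
          survivalProb P Z ~[atTop] (fun t => m⁻¹ * meanSize P Z t) ∧
          Tendsto (condMeanSize P Z) atTop (𝓝 m) ∧
          ∀ s : ℝ, 0 ≤ s → s < 1 →
            Tendsto (fun t => condPGF P Z t s) atTop
              (𝓝 (1 - m * (M - (1 + θ)⁻¹ + (1 - s) ^ (-θ)) ^ (-1 / θ)))) := by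
  have hE : IsEnvironment θ lam a :=
    ⟨hθ0, hθ1, hlam_meas, hlam_nonneg, hlam_int, ha_meas, ha⟩
  refine ⟨fun t => ⟨(integrable_size_and_meanSize_eq hE hZ t).1, survivalProb_pos hE hZ t,
    intervalIntegrable_vIntegrand hE hZ t⟩, ⟨fun h => ⟨h.tendsto_V hE hZ, h.exists_tendsto hE hZ⟩,
    fun ⟨hV, M, hM0, hM⟩ => strictlySubcritical_of_tendsto hE hZ hV hM0 hM⟩, ?_⟩
  rintro h M hM m rfl
  have hM0 : 0 ≤ M := ge_of_tendsto' hM fun t => meanSize_rpow_mul_V_nonneg hE hZ t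
  have hmean := h.tendsto_meanSize hE hZ
  have hm := tendsto_condMeanSize hE hZ hmean hM
  have hmpos : 0 < (M + θ * (1 + θ)⁻¹) ^ (1 / θ) := by positivity
  exact ⟨hmean, isEquivalent_survivalProb hE hZ hmpos.ne' hm, hm,
    fun s hs0 hs1 => tendsto_condPGF hE hZ hmean hM0 hM hs0 hs1⟩
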